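/- Let $A$ be a finite alphabet. A \emph{process} is a probability measure on $A^\infty$; $\mathcal S$ is the set of stationary processes, and $\rho(B)=\rho(X_{1..|B|}=B)$ for a word $B$. A process $\rho\in\mathcal S$ is \emph{ergodic} if for every word $B$ the frequency of $B$ in $X_{1..n}$ tends to $\rho(B)$ $\rho$-almost surely as $n\to\infty$. Fix positive summable weights $w_B$ and give $\mathcal S$ the distributional distance $d(\rho_1,\rho_2)=\sum_B w_B|\rho_1(B)-\rho_2(B)|$; closedness and continuity in $\mathcal S$ refer to $d$. The ergodic decomposition of $\rho\in\mathcal S$ is the probability measure $W_\rho$ on $\mathcal S$ that is concentrated on the ergodic processes and satisfies $\rho(E)=\int\mu(E)\,dW_\rho(\mu)$ for all measurable $E\subseteq A^\infty$. A set $H\subseteq\mathcal S$ is \emph{closed under ergodic decompositions} if $W_\rho(H)=1$ for every $\rho\in H$; it is \emph{continuously parametrized} by a compact space $\Theta$ if it is the image of a continuous map $\Theta\to\mathcal S$. A test $\phi:A^*\to\{0,1\}$ is \emph{uniformly consistent} for $H_0$ against $H_1$ if for every $\alpha>0$ there is $n_\alpha$ such that $\rho(\phi(X_{1..n})=i)<\alpha$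 for all $n\ge n_\alpha$, $i\in\{0,1\}$ and $\rho\in H_{1-i}$. (1) If $H_0,H_1\subseteq\mathcal S$ are disjoint, each is continuously parametrized by a compact space, and each is closed under ergodic decompositions, then there exists a uniformly consistent test of $H_0$ against $H_1$. Examples. A stationary process $\rho$ is a $k$-order Markov source ($k\ge 0$) with transition probabilities $p(\cdot\mid s)$, $s\in A^k$, if $\rho(usa)=\rho(us)\,p(a\mid s)$ for all words $u$ (possibly empty), all $s\in A^k$ and all $a\in A$. Let $\mathcal M_k$ be the set of these sources. (2) For every $k$, the set of pairs $(\pi,p)$ of transition probabilities $p$ of order $k$ and a probability vector $\pi$ on $A^k$ that is invariant under $p$ is compact, and there is a continuous map from it onto $\mathcal M_k$ that sends $(\pi,p)$ to a source with transition probabilities $p$ and with $\rho(s)=\pi(s)$ for all $s\in A^k$. Moreover, $\mathcal M_k$ is closed under ergodic decompositions. (3) If $T$ is a closed set of transition probabilities of order $k$ such that each $p\in T$ is the family of transition probabilities of exactly one stationary process $\rho_p$, then $T$ is compact, $p\mapsto\rho_p$ is continuous on $T$, and $\{\rho_p:p\in T\}$ is closed under ergodic decompositions. (4) Let $H_0\subseteq\mathcal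 M_{k_0}$ and $H_1\subseteq\mathcal M_{k_1}$ be disjoint, consist of ergodic processes, and be closed in $\mathcal S$. Then each $H_i$ is continuously parametrized by a compact space (a set of pairs $(\pi,p)$ as in (2), of order $k_i$) and closed under ergodic decompositions; hence there is a uniformly consistent test of $H_0$ against $H_1$. -/

import Mathlib

open MeasureTheory Filter Topology

namespace ErgodicTesting

/-- The word `X_{t+1}, …, X_{t+n}` of a sequence (sequences are indexed from `0`). -/
def window {A : Type*} (x : ℕ → A) (t n : ℕ) : List A :=
  List.ofFn fun i : Fin n => x (t + i)

/-- Number of occurrences of the word `B` in the word `X` (with `|B| ≤ |X|`). -/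
def occurrences {A : Type*} [DecidableEq A] (X B : List A) : ℕ :=
  ((Finset.range (X.length - B.length + 1)).filter
    fun i => (X.drop i).take B.length = B).card

/-- Frequency `ν(X, B)` of the word `B` in the word `X`. -/
noncomputable def freq {A : Type*} [DecidableEq A] (X B : List A) : ℝ :=
  if B.length ≤ X.length then
    (occurrences X B : ℝ) / ((X.length : ℝ) - (B.length : ℝ) + 1)
  else 0

/-- A process (a probability measure on `A^∞`) is stationary if
`ρ(X_{t+1..t+|B|} = B) = ρ(X_{1..|B|} = B)` for every word `B` and every `t`. -/
def IsStationary {A : Type*} [MeasurableSpace A] (ρ : ProbabilityMeasure (ℕ → A)) : Prop :=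
  ∀ (B : List A) (t : ℕ),
    (ρ : Measure (ℕ → A)) {x | window x t B.length = B} =
      (ρ : Measure (ℕ → A)) {x | window x 0 B.length = B}

/-- The set `𝒮` of stationary processes on `A^∞`, as a type.  For a finite alphabet with its
discrete σ-algebra, the σ-algebra that it inherits from the space of measures (the smallest one
that makes all evaluations `ρ ↦ ρ(E)` measurable) is the Borel σ-algebra of the distributional
distance. -/
abbrev StatProc (A : Type*) [MeasurableSpace A] : Type _ :=
  {ρ : ProbabilityMeasure (ℕ → A) // IsStationary ρ}

/-- The measure on `A^∞` that underlies a stationary process. -/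
abbrev StatProc.law {A : Type*} [MeasurableSpace A] (ρ : StatProc A) : Measure (ℕ → A) :=
  (ρ.1 : Measure (ℕ → A))

/-- `ρ(B) = ρ(X_{1..|B|} = B)`. -/
noncomputable def StatProc.prob {A : Type*} [MeasurableSpace A] (ρ : StatProc A)
    (B : List A) : ℝ :=
  ρ.law.real {x | window x 0 B.length = B}

/-- A stationary process is ergodic if the frequency of every word tends almost surely to its
probability. -/
def IsErgodic {A : Type*} [DecidableEq A] [MeasurableSpace A] (ρ : StatProc A) : Prop :=
  ∀ B : List A, ∀ᵐ x ∂ρ.law,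
    Tendsto (fun n : ℕ => freq (window x 0 n) B) atTop (𝓝 (ρ.prob B))

/-- Distributional distance with weights `w`.  The empty word contributes `0`. -/
noncomputable def distDist {A : Type*} [MeasurableSpace A] (w : List A → ℝ)
    (ρ₁ ρ₂ : StatProc A) : ℝ :=
  ∑' B : List A, w B * |ρ₁.prob B - ρ₂.prob B|

/-- Continuity of a map into the space of stationary processes with the distance `distDist w`. -/
def DistContinuous {A : Type*} [MeasurableSpace A] (w : List A → ℝ)
    {Θ : Type*} [TopologicalSpace Θ] (F : Θ → StatProc A) : Prop :=
  ∀ θ : Θ, Tendsto (fun θ' => distDist w (F θ') (F θ)) (𝓝 θ) (𝓝 0)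

/-- Closedness of a set of stationary processes for the distance `distDist w`. -/
def DistClosed {A : Type*} [MeasurableSpace A] (w : List A → ℝ) (H : Set (StatProc A)) : Prop :=
  ∀ ρ : StatProc A, (∀ ε : ℝ, 0 < ε → ∃ μ ∈ H, distDist w ρ μ < ε) → ρ ∈ H

/-- `Θ` is compact and `H` is the image of `Θ` under a continuous map. -/
def CompactlyParametrized {A : Type*} [MeasurableSpace A] (w : List A → ℝ)
    (Θ : Type*) [TopologicalSpace Θ] (H : Set (StatProc A)) : Prop :=
  CompactSpace Θ ∧ ∃ F : Θ → StatProc A, DistContinuous w F ∧ Set.range F = H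

/-- `W` is an ergodic decomposition of `ρ`: a probability measure on the stationary processes that
is concentrated on the ergodic ones and whose mixture is `ρ`. -/
structure IsErgodicDecomposition {A : Type*} [DecidableEq A] [MeasurableSpace A]
    (W : Measure (StatProc A)) (ρ : StatProc A) : Prop where
  isProbabilityMeasure : IsProbabilityMeasure W
  ergodic : ∀ᵐ μ ∂W, IsErgodic μ
  mixture : ∀ E : Set (ℕ → A), MeasurableSet E → ρ.law E = ∫⁻ μ, μ.law E ∂W

/-- `W_ρ(H) = 1` for every `ρ ∈ H`, where `W_ρ` is the ergodic decomposition of `ρ`. -/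
def ClosedUnderErgodicDecomposition {A : Type*} [DecidableEq A] [MeasurableSpace A]
    (H : Set (StatProc A)) : Prop :=
  ∀ ρ ∈ H, ∀ W : Measure (StatProc A), IsErgodicDecomposition W ρ → ∀ᵐ μ ∂W, μ ∈ H

/-- Uniform consistency of a test `φ` of `H₀` against `H₁`. -/
def UniformlyConsistent {A : Type*} [MeasurableSpace A] (φ : List A → Fin 2)
    (H₀ H₁ : Set (StatProc A)) : Prop :=
  ∀ α : ℝ, 0 < α → ∃ N : ℕ, ∀ n : ℕ, N ≤ n →
    (∀ ρ ∈ H₀, ρ.law.real {x | φ (window x 0 n) = 1} < α) ∧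
    (∀ ρ ∈ H₁, ρ.law.real {x | φ (window x 0 n) = 0} < α)

/-- Transition probabilities of order `k`: a probability vector on `A` for each word in `A^k`. -/
abbrev Transitions (k : ℕ) (A : Type*) [Fintype A] : Type _ :=
  (Fin k → A) → stdSimplex ℝ A

/-- The conditional probability that `a` comes next, given the whole past `u s` with `s ∈ A^k`,
is `p(a | s)`. -/
def HasTransitions {A : Type*} [Fintype A] [MeasurableSpace A] {k : ℕ}
    (p : Transitions k A) (ρ : StatProc A) : Prop :=
  ∀ (u : List A) (s : Fin k → A) (a : A),
    ρ.prob (u ++ List.ofFn s ++ [a]) = ρ.prob (u ++ List.ofFn s) * (p s : A → ℝ) a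

/-- The set of (stationary) `k`-order Markov sources. -/
def markovSources (k : ℕ) (A : Type*) [Fintype A] [MeasurableSpace A] : Set (StatProc A) :=
  {ρ | ∃ p : Transitions k A, HasTransitions p ρ}

/-- Pairs of a probability vector `π` on `A^k` and transition probabilities `p` of order `k` such
that `π` is invariant: if `s` has law `π` and `a` has law `p(· | s)`, then the last `k` letters of
the word `s a` have law `π`. -/
abbrev MarkovParam (k : ℕ) (A : Type*) [Fintype A] [DecidableEq A] : Type _ :=
  {θ : stdSimplex ℝ (Fin k → A) × Transitions k A //
    ∀ v : Fin k → A,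
      (∑ s : Fin k → A, ∑ a : A,
        if Fin.tail (Fin.snoc s a : Fin (k + 1) → A) = v then
          (θ.1 : (Fin k → A) → ℝ) s * (θ.2 s : A → ℝ) a else 0) =
      (θ.1 : (Fin k → A) → ℝ) v}

end ErgodicTesting

/-!
The tests come from a convexity argument. Suppose that the mixtures of processes in `H₀` and the
mixtures of processes in `H₁` have `n`-letter marginals that are almost mutually singular, uniformly
over all pairs of mixtures. Then the Hahn-Banach theorem, applied to the two convex sets of
marginals and an open `ℓ¹`-ball, yields a function on words of length `n` with values in `[-1, 1]`
whose sign is a test with small errors, uniformly over `H₀` and `H₁`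
(`exists_separating_event`). Such an `n` exists for every error level
(`exists_forall_lt_sum_abs_mixtureMarginal`): otherwise, the space of pairs of mixing measures being
compact, a single pair of mixtures `P`, `Q` would fail to be almost singular for all `n`, hence
would not be mutually singular (`exists_lt_sum_abs_sub`). But closedness under ergodic
decompositions forces the word frequencies to converge `P`-almost surely to the word probabilities
of a process in `H₀`, and `Q`-almost surely to those of a process in `H₁`
(`measure_compl_freqLimitIn`), and these two events are disjoint.

That last step needs the existence of the ergodic decomposition
(`exists_isErgodicDecomposition`). It is the law of the regular conditional probability given the
shift-invariant events; that almost every conditional measure is ergodic follows from the pointwise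
ergodic theorem (`ae_tendsto_birkhoffAverage`), which is derived from the maximal ergodic theorem.

Markov sources are constructed as cluster points of measures that follow the transition
probabilities for more and more letters (`exists_hasTransitions`). A source is determined by its
parameters and the relation between the two is closed, so compactness of the space of stationary
processes makes it depend continuously on them (`continuous_prob_of_isClosed`). Almost every
component of a source with transition probabilities `p` has the same transition probabilities
(`HasTransitions.ae_of_isErgodicDecomposition`): the fluctuations of the occurrences of `usa` around
the share `p(a | s)` of the occurrences of `us` are orthogonal at different times, so the square of
the mean fluctuation of a component, averaged over the components, is at most `1 / n` for all `n`.
The ergodic decomposition of an ergodic process is a point mass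
(`ae_eq_of_isErgodicDecomposition_of_isErgodic`), which settles closed sets of ergodic sources.
-/

namespace ErgodicTesting

/-! ### Words, cylinders and the shift -/

section Words

variable {A : Type*}

/-- The cylinder of the sequences that begin with the word `B`. -/
def wordSet (B : List A) : Set (ℕ → A) := {x | window x 0 B.length = B}

/-- The left shift on sequences. -/
def shift (x : ℕ → A) : ℕ → A := fun n => x (n + 1)

@[simp] lemma length_window (x : ℕ → A) (t n : ℕ) : (window x t n).length = n := by
  simp [window]

lemma window_eq_iff {x : ℕ → A} {t n : ℕ} {B : List A} :
    window x t n = B ↔ n = B.length ∧ ∀ (i : ℕ) (h : i < B.length), x (t + i) = B[i] := by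
  constructor
  · rintro rfl
    simp [window]
  · rintro ⟨rfl, h⟩
    apply List.ext_getElem (by simp)
    intro i h1 h2
    simp [window, h i h2]

lemma mem_wordSet {x : ℕ → A} {B : List A} :
    x ∈ wordSet B ↔ ∀ (i : ℕ) (h : i < B.length), x i = B[i] := by
  simp [wordSet, window_eq_iff]

lemma mem_wordSet_append {x : ℕ → A} {B C : List A} :
    x ∈ wordSet (B ++ C) ↔ x ∈ wordSet B ∧ window x B.length C.length = C := by
  simp only [mem_wordSet, window_eq_iff, List.length_append, true_and]
  constructor
  · intro h
    refine ⟨fun i hi => ?_, fun i hi => ?_⟩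
    · rw [h i (by omega), List.getElem_append_left hi]
    · rw [h (B.length + i) (by omega)]
      simp
  · rintro ⟨h1, h2⟩ i hi
    rcases lt_or_ge i B.length with h | h
    · rw [h1 i h, List.getElem_append_left h]
    · have := h2 (i - B.length) (by omega)
      rw [List.getElem_append_right h, ← this]
      congr 1
      omega

lemma window_one {x : ℕ → A} {t : ℕ} {a : A} : window x t 1 = [a] ↔ x t = a := by
  simp [window]

lemma mem_wordSet_concat {x : ℕ → A} {B : List A} {a : A} :
    x ∈ wordSet (B ++ [a]) ↔ x ∈ wordSet B ∧ x B.length = a := by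
  rw [mem_wordSet_append, List.length_singleton, window_one]

lemma mem_wordSet_cons {x : ℕ → A} {B : List A} {a : A} :
    x ∈ wordSet (a :: B) ↔ x 0 = a ∧ shift x ∈ wordSet B := by
  simp only [mem_wordSet, shift]
  constructor
  · intro h
    exact ⟨h 0 (by simp), fun i hi => h (i + 1) (by simpa using hi)⟩
  · rintro ⟨h0, h⟩ i hi
    cases i with
    | zero => simpa using h0
    | succ i => simpa using h i (by simpa using hi)

@[simp] lemma wordSet_nil : wordSet ([] : List A) = Set.univ := by
  ext x; simp [mem_wordSet]

lemma iterate_shift (x : ℕ → A) (n i : ℕ) : shift^[n] x i = x (n + i) := by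
  induction n generalizing i with
  | zero => simp
  | succ n ih =>
    rw [Function.iterate_succ_apply']
    simp only [shift, ih]
    congr 1; omega

lemma window_iterate_shift (x : ℕ → A) (m t n : ℕ) :
    window (shift^[m] x) t n = window x (m + t) n := by
  simp [window, iterate_shift, add_assoc]

lemma mem_wordSet_window (x : ℕ → A) (n : ℕ) : x ∈ wordSet (window x 0 n) := by
  simp [wordSet]

lemma take_window (x : ℕ → A) {m n : ℕ} (h : m ≤ n) : (window x 0 n).take m = window x 0 m := by
  apply List.ext_getElem
  · simp [h]
  · intro i h1 h2
    simp [window]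

lemma isPiSystem_wordSet : IsPiSystem (Set.range (wordSet : List A → Set (ℕ → A))) := by
  have key : ∀ B C : List A, B.length ≤ C.length → (wordSet B ∩ wordSet C).Nonempty →
      wordSet B ∩ wordSet C = wordSet C := by
    rintro B C h ⟨x, hB, hC⟩
    refine Set.inter_eq_right.2 fun y hy => ?_
    rw [mem_wordSet] at *
    intro i hi
    rw [hy i (by omega), ← hC i (by omega), hB i hi]
  rintro _ ⟨B, rfl⟩ _ ⟨C, rfl⟩ hne
  rcases le_total B.length C.length with h | h
  · exact ⟨C, (key B C h hne).symm⟩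
  · exact ⟨B, by rw [Set.inter_comm] at hne ⊢; exact (key C B h hne).symm⟩

variable [MeasurableSpace A]

lemma measurable_shift : Measurable (shift : (ℕ → A) → ℕ → A) :=
  measurable_pi_iff.2 fun n => measurable_pi_apply (n + 1)

lemma StatProc.prob_eq (ρ : StatProc A) (B : List A) : ρ.prob B = ρ.law.real (wordSet B) := rfl

lemma StatProc.prob_nonneg (ρ : StatProc A) (B : List A) : 0 ≤ ρ.prob B := measureReal_nonneg

lemma StatProc.prob_le_one (ρ : StatProc A) (B : List A) : ρ.prob B ≤ 1 := measureReal_le_one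

variable [Finite A] [DiscreteMeasurableSpace A]

lemma measurableSet_window (t n : ℕ) (D : Set (List A)) :
    MeasurableSet {x : ℕ → A | window x t n ∈ D} := by
  have hm : Measurable fun (x : ℕ → A) (i : Fin n) => x (t + i) :=
    measurable_pi_iff.2 fun i => measurable_pi_apply _
  exact hm (Set.toFinite {v : Fin n → A | List.ofFn v ∈ D}).measurableSet

lemma measurableSet_wordSet (B : List A) : MeasurableSet (wordSet B) :=
  measurableSet_window 0 B.length {B}

lemma measurable_comp_window (t n : ℕ) {β : Type*} [MeasurableSpace β] (f : List A → β) :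
    Measurable fun x : ℕ → A => f (window x t n) := fun s _ =>
  measurableSet_window t n (f ⁻¹' s)

lemma generateFrom_wordSet : (inferInstance : MeasurableSpace (ℕ → A)) =
    MeasurableSpace.generateFrom (Set.range (wordSet : List A → Set (ℕ → A))) := by
  apply le_antisymm
  · refine iSup_le fun i => ?_
    rintro _ ⟨s, -, rfl⟩
    have : (fun x : ℕ → A => x i) ⁻¹' s =
        ⋃ B ∈ {B : List A | ∃ h : i < B.length, B[i] ∈ s}, wordSet B := by
      ext x
      simp only [Set.mem_preimage, Set.mem_iUnion, Set.mem_ofPred_eq, exists_prop]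
      constructor
      · intro h
        exact ⟨window x 0 (i + 1), ⟨by simp,
          by simpa only [window, List.getElem_ofFn, zero_add] using h⟩,
          mem_wordSet_window x _⟩
      · rintro ⟨B, ⟨h, hB⟩, hx⟩
        rwa [mem_wordSet.1 hx i h]
    rw [this]
    exact MeasurableSet.biUnion (Set.to_countable _) fun B _ =>
      MeasurableSpace.measurableSet_generateFrom ⟨B, rfl⟩
  · apply MeasurableSpace.generateFrom_le
    rintro _ ⟨B, rfl⟩
    exact measurableSet_wordSet B

/-- Every cylinder is the disjoint union of the cylinders of its one-letter extensions. -/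
lemma measure_wordSet_eq_sum [Fintype A] (μ : Measure (ℕ → A)) (B : List A) :
    μ (wordSet B) = ∑ a, μ (wordSet (B ++ [a])) := by
  classical
  rw [← measure_biUnion_finset]
  · congr 1
    ext x
    simp [mem_wordSet_concat]
  · intro a _ b _ hab
    refine Set.disjoint_left.2 fun x h1 h2 => hab ?_
    rw [mem_wordSet_concat] at h1 h2
    exact h1.2.symm.trans h2.2
  · exact fun a _ => measurableSet_wordSet _

lemma measure_preimage_shift_eq_sum [Fintype A] (μ : Measure (ℕ → A)) (B : List A) :
    μ (shift ⁻¹' wordSet B) = ∑ a, μ (wordSet (a :: B)) := by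
  classical
  rw [← measure_biUnion_finset]
  · congr 1
    ext x
    simp [mem_wordSet_cons]
  · intro a _ b _ hab
    refine Set.disjoint_left.2 fun x h1 h2 => hab ?_
    rw [mem_wordSet_cons] at h1 h2
    exact h1.1.symm.trans h2.1
  · exact fun a _ => measurableSet_wordSet _

/-- A finite measure is determined by the cylinders of all words of length at least `k`. -/
lemma measure_ext_of_wordSet {μ ν : Measure (ℕ → A)} [IsFiniteMeasure μ] (k : ℕ)
    (h : ∀ B : List A, k ≤ B.length → μ (wordSet B) = ν (wordSet B)) : μ = ν := by
  have : Fintype A := Fintype.ofFinite A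
  have all : ∀ (j : ℕ) (B : List A), k ≤ B.length + j → μ (wordSet B) = ν (wordSet B) := by
    intro j
    induction j with
    | zero => exact h
    | succ j ih =>
      intro B hB
      rw [measure_wordSet_eq_sum μ, measure_wordSet_eq_sum ν]
      exact Finset.sum_congr rfl fun a _ => ih _ (by simp; omega)
  refine ext_of_generate_finite _ generateFrom_wordSet isPiSystem_wordSet ?_ ?_
  · rintro _ ⟨B, rfl⟩
    exact all k B (by omega)
  · simpa using all k [] (by simp)

lemma isStationary_iff_map_shift (ρ : ProbabilityMeasure (ℕ → A)) :
    IsStationary ρ ↔ (ρ : Measure (ℕ → A)).map shift = ρ := by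
  constructor
  · intro h
    have : IsFiniteMeasure ((ρ : Measure (ℕ → A)).map shift) := by infer_instance
    refine measure_ext_of_wordSet 0 fun B _ => ?_
    rw [Measure.map_apply measurable_shift (measurableSet_wordSet B)]
    have := h B 1
    simpa [wordSet, Set.preimage, ← window_iterate_shift _ 1 0] using this
  · intro h B t
    have hmp : MeasurePreserving shift (ρ : Measure (ℕ → A)) ρ := ⟨measurable_shift, h⟩
    change _ = (ρ : Measure (ℕ → A)) (wordSet B)
    rw [← (hmp.iterate t).measure_preimage (measurableSet_wordSet B).nullMeasurableSet]
    congr 1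
    ext x
    simp [wordSet, window_iterate_shift]

lemma StatProc.measurePreserving (ρ : StatProc A) : MeasurePreserving shift ρ.law ρ.law :=
  ⟨measurable_shift, (isStationary_iff_map_shift ρ.1).1 ρ.2⟩

lemma StatProc.ext_of_prob {ρ ρ' : StatProc A} (k : ℕ)
    (h : ∀ B : List A, k ≤ B.length → ρ.prob B = ρ'.prob B) : ρ = ρ' := by
  refine Subtype.ext (Subtype.ext ?_)
  change ρ.law = ρ'.law
  refine measure_ext_of_wordSet k fun B hB => ?_
  exact (measureReal_eq_measureReal_iff (μ := ρ.law) (ν := ρ'.law)).1 (h B hB)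

lemma StatProc.sum_prob_concat [Fintype A] (ρ : StatProc A) (B : List A) :
    ∑ a, ρ.prob (B ++ [a]) = ρ.prob B := by
  simp only [StatProc.prob_eq, Measure.real]
  rw [measure_wordSet_eq_sum, ENNReal.toReal_sum fun a _ => measure_ne_top _ _]

lemma StatProc.sum_prob_cons [Fintype A] (ρ : StatProc A) (B : List A) :
    ∑ a, ρ.prob (a :: B) = ρ.prob B := by
  simp only [StatProc.prob_eq, Measure.real]
  rw [← ρ.measurePreserving.measure_preimage (measurableSet_wordSet B).nullMeasurableSet,
    measure_preimage_shift_eq_sum, ENNReal.toReal_sum fun a _ => measure_ne_top _ _]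

end Words

/-! ### The pointwise ergodic theorem for bounded functions -/

section Birkhoff

variable {X : Type*} {T : X → X} {f g : X → ℝ}

/-- `maxSum T g n x = max (0, S₁ g x, …, Sₙ g x)`, where `Sₖ g` is the Birkhoff sum of `g`. -/
noncomputable def maxSum (T : X → X) (g : X → ℝ) : ℕ → X → ℝ
  | 0 => 0
  | n + 1 => fun x => max 0 (g x + maxSum T g n (T x))

lemma maxSum_nonneg (n : ℕ) (x : X) : 0 ≤ maxSum T g n x := by
  cases n with
  | zero => simp [maxSum]
  | succ n => exact le_max_left _ _

lemma maxSum_le_succ (n : ℕ) : ∀ x, maxSum T g n x ≤ maxSum T g (n + 1) x := by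
  induction n with
  | zero => exact fun x => maxSum_nonneg 1 x
  | succ n ih => exact fun x => max_le_max le_rfl (by linarith [ih (T x)])

lemma birkhoffSum_le_maxSum (n : ℕ) : ∀ x, birkhoffSum T g n x ≤ maxSum T g n x := by
  induction n with
  | zero => simp [maxSum]
  | succ n ih =>
    intro x
    rw [birkhoffSum_succ']
    exact le_max_of_le_right (by linarith [ih (T x)])

variable [MeasurableSpace X] {μ : Measure X}

lemma integrable_maxSum (hT : MeasurePreserving T μ μ) (hg : Integrable g μ) (n : ℕ) :
    Integrable (maxSum T g n) μ := by
  induction n with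
  | zero => exact integrable_zero _ _ _
  | succ n ih =>
    have : Integrable (fun x => maxSum T g n (T x)) μ := hT.integrable_comp_of_integrable ih
    exact (integrable_zero X ℝ μ).sup (hg.add this)

lemma measurable_maxSum (hT : Measurable T) (hg : Measurable g) (n : ℕ) :
    Measurable (maxSum T g n) := by
  induction n with
  | zero => exact measurable_const
  | succ n ih => exact measurable_const.max (hg.add (ih.comp hT))

/-- The maximal ergodic theorem, for a function whose Birkhoff sums become positive almost
everywhere. -/
lemma integral_nonneg_of_exists_birkhoffSum_pos (hT : MeasurePreserving T μ μ)
    (hgm : Measurable g) (hg : Integrable g μ) (hpos : ∀ᵐ x ∂μ, ∃ n, 0 < birkhoffSum T g n x) :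
    0 ≤ ∫ x, g x ∂μ := by
  set s : ℕ → Set X := fun n => {x | 0 < maxSum T g n x} with hs
  have hsm : ∀ n, MeasurableSet (s n) := fun n =>
    measurableSet_lt measurable_const (measurable_maxSum hT.measurable hgm n)
  have hmono : Monotone s := monotone_nat_of_le_succ fun n x hx =>
    lt_of_lt_of_le hx (maxSum_le_succ n x)
  have hlim := tendsto_setIntegral_of_monotone hsm hmono hg.integrableOn
  have huniv : (⋃ n, s n) =ᵐ[μ] Set.univ := by
    rw [eventuallyEq_univ]
    filter_upwards [hpos] with x ⟨n, hn⟩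
    exact Set.mem_iUnion.2 ⟨n, hn.trans_le (birkhoffSum_le_maxSum n x)⟩
  rw [setIntegral_congr_set huniv, setIntegral_univ] at hlim
  refine ge_of_tendsto ((tendsto_add_atTop_iff_nat 1).2 hlim) (Eventually.of_forall fun n => ?_)
  have hi := integrable_maxSum hT hg n
  have hi' := integrable_maxSum hT hg (n + 1)
  have hiT : Integrable (fun x => maxSum T g n (T x)) μ := hT.integrable_comp_of_integrable hi
  have h1 : ∫ x, maxSum T g n (T x) ∂μ = ∫ x, maxSum T g n x ∂μ := by
    have h := integral_map hT.measurable.aemeasurable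
      (f := maxSum T g n) (by rw [hT.map_eq]; exact hi.aestronglyMeasurable)
    rw [hT.map_eq] at h
    exact h.symm
  -- Where `maxSum T g (n + 1)` is positive, it equals `g + maxSum T g n ∘ T`.
  have h2 : ∀ x, maxSum T g (n + 1) x - maxSum T g n (T x) ≤ (s (n + 1)).indicator g x := by
    intro x
    by_cases hx : x ∈ s (n + 1)
    · rw [Set.indicator_of_mem hx]
      have hx' : 0 < max 0 (g x + maxSum T g n (T x)) := hx
      have : maxSum T g (n + 1) x = g x + maxSum T g n (T x) :=
        max_eq_right (by
          rcases lt_max_iff.1 hx' with h | h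
          · exact absurd h (lt_irrefl _)
          · exact h.le)
      linarith
    · rw [Set.indicator_of_notMem hx]
      have : maxSum T g (n + 1) x ≤ 0 := not_lt.1 hx
      linarith [maxSum_nonneg (T := T) (g := g) n (T x)]
  calc (0 : ℝ) ≤ ∫ x, maxSum T g (n + 1) x ∂μ - ∫ x, maxSum T g n x ∂μ :=
        sub_nonneg.2 (integral_mono hi hi' (maxSum_le_succ n))
    _ = ∫ x, (maxSum T g (n + 1) x - maxSum T g n (T x)) ∂μ := by
        rw [integral_sub hi' hiT, h1]
    _ ≤ ∫ x, (s (n + 1)).indicator g x ∂μ :=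
        integral_mono (hi'.sub hiT) (hg.indicator (hsm _)) h2
    _ = ∫ x in s (n + 1), g x ∂μ := integral_indicator (hsm _)

variable [IsProbabilityMeasure μ]

/-- The upper half of the pointwise ergodic theorem. -/
lemma ae_eventually_birkhoffAverage_le (hT : MeasurePreserving T μ μ) (hf : Measurable f)
    {C : ℝ} (hC : ∀ x, |f x| ≤ C) {ε : ℝ} (hε : 0 < ε) :
    ∀ᵐ x ∂μ, ∀ δ, ε < δ → ∀ᶠ n in atTop,
      birkhoffAverage ℝ T f n x ≤ (μ[f|MeasurableSpace.invariants T]) x + δ := by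
  have hI := MeasurableSpace.invariants_le (α := X) T
  set E := μ[f|MeasurableSpace.invariants T] with hE
  have hEI : Measurable[MeasurableSpace.invariants T] E := stronglyMeasurable_condExp.measurable
  have hEm : Measurable E := hEI.mono hI le_rfl
  have hEinv : ∀ x, E (T x) = E x := fun x =>
    congrFun (MeasurableSpace.comp_eq_of_measurable_invariants hEI) x
  have hfi : Integrable f μ := Integrable.of_bound hf.aestronglyMeasurable C
    (Eventually.of_forall hC)
  have hEi : Integrable E μ := integrable_condExp
  have hAm : ∀ n, Measurable (birkhoffAverage ℝ T f n) := fun n => by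
    unfold birkhoffAverage birkhoffSum
    exact (Finset.measurable_fun_sum _ fun i _ =>
      hf.comp (hT.measurable.iterate i)).const_smul ((n : ℝ)⁻¹)
  have hdiff : ∀ x, Tendsto (fun n => birkhoffAverage ℝ T f n (T x) - birkhoffAverage ℝ T f n x)
      atTop (𝓝 0) := fun x => by
    apply tendsto_birkhoffAverage_apply_sub_birkhoffAverage'
    exact isBounded_iff_forall_norm_le.2 ⟨C, by rintro _ ⟨x, rfl⟩; exact hC x⟩
  -- The set where the averages exceed `E + ε` infinitely often, by a fixed margin so that the
  -- set is invariant under `T`.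
  set B : Set X := {x | ∃ k : ℕ, ∃ᶠ n in atTop,
    E x + ε + 1 / ((k : ℝ) + 1) < birkhoffAverage ℝ T f n x} with hB
  have hBm : MeasurableSet B := by
    have : B = ⋃ k : ℕ, limsup (fun n => {x | E x + ε + 1 / ((k : ℝ) + 1) <
        birkhoffAverage ℝ T f n x}) atTop := by
      ext x
      simp [hB, mem_limsup_iff_frequently_mem]
    rw [this]
    exact MeasurableSet.iUnion fun k => MeasurableSet.measurableSet_limsup fun n =>
      measurableSet_lt ((hEm.add_const _).add_const _) (hAm n)
  have step : ∀ x y, E x = E y → Tendsto (fun n => birkhoffAverage ℝ T f n y -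
      birkhoffAverage ℝ T f n x) atTop (𝓝 0) → x ∈ B → y ∈ B := by
    rintro x y hxy hlim ⟨k, hk⟩
    refine ⟨k + 1, ?_⟩
    have hlt : 1 / (((k + 1 : ℕ) : ℝ) + 1) - 1 / ((k : ℝ) + 1) < 0 :=
      sub_neg.2 (one_div_lt_one_div_of_lt (by positivity) (by push_cast; linarith))
    refine (hk.and_eventually (hlim.eventually (lt_mem_nhds hlt))).mono fun n ⟨h1, h2⟩ => ?_
    rw [← hxy]
    linarith
  have hBinv : T ⁻¹' B = B := by
    ext x
    constructor
    · exact step (T x) x (hEinv x) (by simpa using (hdiff x).neg)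
    · exact step x (T x) (hEinv x).symm (hdiff x)
  have hBI : MeasurableSet[MeasurableSpace.invariants T] B :=
    MeasurableSpace.measurableSet_invariants.2 ⟨hBm, hBinv⟩
  have hTB : MeasurePreserving T (μ.restrict B) (μ.restrict B) := by
    have := hT.restrict_preimage hBm
    rwa [hBinv] at this
  have hgm : Measurable fun x => f x - E x - ε := (hf.sub hEm).sub_const _
  have hgi : Integrable (fun x => f x - E x - ε) μ := (hfi.sub hEi).sub (integrable_const _)
  have h0 : 0 ≤ ∫ x in B, (f x - E x - ε) ∂μ := by
    refine integral_nonneg_of_exists_birkhoffSum_pos hTB hgm hgi.integrableOn ?_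
    filter_upwards [ae_restrict_mem hBm] with x ⟨k, hk⟩
    obtain ⟨n, hn, hn0⟩ := (hk.and_eventually (eventually_gt_atTop 0)).exists
    refine ⟨n, ?_⟩
    have hEit : ∀ i, E (T^[i] x) = E x := fun i => by
      induction i with
      | zero => rfl
      | succ i ih => rw [Function.iterate_succ_apply', hEinv, ih]
    have hn0' : (0 : ℝ) < n := Nat.cast_pos.2 hn0
    have hS : birkhoffSum T (fun x => f x - E x - ε) n x =
        n * (birkhoffAverage ℝ T f n x - E x - ε) := by
      simp only [birkhoffSum, birkhoffAverage, hEit, Finset.sum_sub_distrib, smul_eq_mul,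
        Finset.sum_const, Finset.card_range, nsmul_eq_mul]
      field_simp
    rw [hS]
    have : 0 < 1 / ((k : ℝ) + 1) := by positivity
    exact mul_pos hn0' (by linarith)
  have h1 : ∫ x in B, (f x - E x - ε) ∂μ = -(μ.real B * ε) := by
    have hfE : IntegrableOn (fun x => f x - E x) B μ := (hfi.sub hEi).integrableOn
    rw [integral_sub hfE (integrable_const _).integrableOn,
      integral_sub hfi.integrableOn hEi.integrableOn, setIntegral_condExp hI hfi hBI]
    simp
  have hB0 : μ.real B = 0 := by
    have := measureReal_nonneg (μ := μ) (s := B)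
    nlinarith
  rw [measureReal_eq_zero_iff] at hB0
  filter_upwards [measure_eq_zero_iff_ae_notMem.1 hB0] with x hx δ hδ
  obtain ⟨k, hk⟩ := exists_nat_one_div_lt (sub_pos.2 hδ)
  have : ¬ ∃ᶠ n in atTop, E x + ε + 1 / ((k : ℝ) + 1) < birkhoffAverage ℝ T f n x :=
    fun h => hx ⟨k, h⟩
  rw [not_frequently] at this
  filter_upwards [this] with n hn
  linarith

/-- The pointwise ergodic theorem for bounded measurable functions. -/
theorem ae_tendsto_birkhoffAverage (hT : MeasurePreserving T μ μ) (hf : Measurable f)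
    {C : ℝ} (hC : ∀ x, |f x| ≤ C) :
    ∀ᵐ x ∂μ, Tendsto (fun n => birkhoffAverage ℝ T f n x) atTop
      (𝓝 ((μ[f|MeasurableSpace.invariants T]) x)) := by
  have hup : ∀ᵐ x ∂μ, ∀ m : ℕ, ∀ δ, 1 / ((m : ℝ) + 1) < δ → ∀ᶠ n in atTop,
      birkhoffAverage ℝ T f n x ≤ (μ[f|MeasurableSpace.invariants T]) x + δ :=
    ae_all_iff.2 fun m => ae_eventually_birkhoffAverage_le hT hf hC (by positivity)
  have hlo : ∀ᵐ x ∂μ, ∀ m : ℕ, ∀ δ, 1 / ((m : ℝ) + 1) < δ → ∀ᶠ n in atTop,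
      birkhoffAverage ℝ T (-f) n x ≤ (μ[-f|MeasurableSpace.invariants T]) x + δ :=
    ae_all_iff.2 fun m => ae_eventually_birkhoffAverage_le hT hf.neg (C := C)
      (fun x => by simpa using hC x) (by positivity)
  filter_upwards [hup, hlo, condExp_neg f (MeasurableSpace.invariants T)] with x h1 h2 h3
  rw [Metric.tendsto_atTop']
  intro δ hδ
  obtain ⟨m, hm⟩ := exists_nat_one_div_lt (half_pos hδ)
  obtain ⟨N, hN⟩ := eventually_atTop.1 ((h1 m _ hm).and (h2 m _ hm))
  refine ⟨N, fun n hn => ?_⟩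
  obtain ⟨ha, hb⟩ := hN n hn.le
  have hneg : birkhoffAverage ℝ T (-f) n x = -birkhoffAverage ℝ T f n x := by
    simp [birkhoffAverage, birkhoffSum]
  rw [h3, hneg, Pi.neg_apply] at hb
  rw [Real.dist_eq, abs_lt]
  constructor <;> linarith

end Birkhoff

/-! ### Ergodic decompositions -/

section Frequencies

variable {A : Type*} [DecidableEq A]

/-- The frequency of every word `B` in the initial words of `x` tends to `l B`. -/
def FreqTendsto (x : ℕ → A) (l : List A → ℝ) : Prop :=
  Tendsto (fun n B => freq (window x 0 n) B) atTop (𝓝 l)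

lemma freqTendsto_iff {x : ℕ → A} {l : List A → ℝ} :
    FreqTendsto x l ↔ ∀ B, Tendsto (fun n => freq (window x 0 n) B) atTop (𝓝 (l B)) :=
  tendsto_pi_nhds

lemma FreqTendsto.unique {x : ℕ → A} {l l' : List A → ℝ} (h : FreqTendsto x l)
    (h' : FreqTendsto x l') : l = l' := tendsto_nhds_unique h h'

lemma freq_window_eq_birkhoffAverage (x : ℕ → A) {n : ℕ} {B : List A} (h : B.length ≤ n) :
    freq (window x 0 n) B =
      birkhoffAverage ℝ shift ((wordSet B).indicator 1) (n - B.length + 1) x := by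
  have key : ∀ i ∈ Finset.range (n - B.length + 1),
      (((window x 0 n).drop i).take B.length = B ↔ shift^[i] x ∈ wordSet B) := by
    intro i hi
    have hi' := Finset.mem_range.1 hi
    have : ((window x 0 n).drop i).take B.length = window x i B.length := by
      apply List.ext_getElem
      · simp; omega
      · intro j h1 h2
        simp [window]
    rw [this, wordSet, Set.mem_ofPred_eq, window_iterate_shift]
    rfl
  have hcast : ((n : ℝ) - (B.length : ℝ) + 1) = ((n - B.length + 1 : ℕ) : ℝ) := by
    push_cast [Nat.cast_sub h]; ring
  classical
  simp only [freq, length_window, if_pos h, occurrences, birkhoffAverage, birkhoffSum, smul_eq_mul]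
  rw [hcast, Finset.filter_congr key, Finset.card_filter, div_eq_inv_mul]
  congr 1
  push_cast
  exact Finset.sum_congr rfl fun i _ => by simp [Set.indicator_apply]

end Frequencies

section Decomposition

open ProbabilityTheory

variable {A : Type*} [MeasurableSpace A]

lemma measurable_law : Measurable (StatProc.law : StatProc A → Measure (ℕ → A)) :=
  measurable_subtype_coe.comp measurable_subtype_coe

/-- The mixture property of a decomposition, as an identity of integrals. -/
lemma lintegral_eq_of_isErgodicDecomposition [DecidableEq A] {W : Measure (StatProc A)}
    {ρ : StatProc A}
    (h : IsErgodicDecomposition W ρ) {f : (ℕ → A) → ENNReal} (hf : Measurable f) :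
    ∫⁻ x, f x ∂ρ.law = ∫⁻ μ, ∫⁻ x, f x ∂μ.law ∂W := by
  have : ρ.law = W.bind StatProc.law := by
    ext E hE
    rw [h.mixture E hE, Measure.bind_apply hE measurable_law.aemeasurable]
  rw [this, Measure.lintegral_bind measurable_law.aemeasurable hf.aemeasurable]

/-- The conditional probability of a word given the shift-invariant events. -/
noncomputable def condWord (ρ : StatProc A) (B : List A) : (ℕ → A) → ℝ :=
  ρ.law[(wordSet B).indicator (fun _ => (1 : ℝ))|MeasurableSpace.invariants shift]

lemma measurable_condWord (ρ : StatProc A) (B : List A) :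
    Measurable[MeasurableSpace.invariants shift] (condWord ρ B) :=
  stronglyMeasurable_condExp.measurable

lemma isErgodic_iff [DecidableEq A] [Countable A] {ρ : StatProc A} :
    IsErgodic ρ ↔ ∀ᵐ x ∂ρ.law, FreqTendsto x ρ.prob := by
  simp only [freqTendsto_iff, ae_all_iff]
  rfl

variable [Finite A] [DiscreteMeasurableSpace A]

lemma measurable_prob (B : List A) : Measurable fun ρ : StatProc A => ρ.prob B :=
  ((Measure.measurable_coe (measurableSet_wordSet B)).comp measurable_law).ennreal_toReal

lemma condExp_indicator_preimage_shift (ρ : StatProc A) {s : Set (ℕ → A)} (hs : MeasurableSet s) :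
    ρ.law[(shift ⁻¹' s).indicator (fun _ => (1 : ℝ))|MeasurableSpace.invariants shift] =ᵐ[ρ.law]
      ρ.law[s.indicator (fun _ => (1 : ℝ))|MeasurableSpace.invariants shift] := by
  have hI := MeasurableSpace.invariants_le (α := ℕ → A) shift
  have hi : ∀ {t : Set (ℕ → A)}, MeasurableSet t →
      Integrable (t.indicator fun _ => (1 : ℝ)) ρ.law := fun ht =>
    (integrable_const (1 : ℝ)).indicator ht
  have hs' := measurable_shift hs
  refine (ae_eq_condExp_of_forall_setIntegral_eq hI (hi hs)
    (fun _ _ _ => integrable_condExp.integrableOn) (fun t ht _ => ?_)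
    stronglyMeasurable_condExp.aestronglyMeasurable)
  have ht' := MeasurableSpace.measurableSet_invariants.1 ht
  rw [setIntegral_condExp hI (hi hs') ht, integral_indicator_const _ hs',
    integral_indicator_const _ hs]
  congr 1
  rw [measureReal_restrict_apply hs', measureReal_restrict_apply hs]
  -- `t` is invariant, so that `shift⁻¹ s ∩ t` is the preimage of `s ∩ t`.
  have : shift ⁻¹' s ∩ t = shift ⁻¹' (s ∩ t) := by rw [Set.preimage_inter, ht'.2]
  rw [this, measureReal_def, measureReal_def,
    ρ.measurePreserving.measure_preimage (hs.inter ht'.1).nullMeasurableSet]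

variable [DecidableEq A]

lemma measurable_freq (n : ℕ) :
    Measurable fun (x : ℕ → A) (B : List A) => freq (window x 0 n) B :=
  measurable_pi_iff.2 fun B => measurable_comp_window 0 n fun X => freq X B

lemma measurableSet_isErgodic : MeasurableSet {ρ : StatProc A | IsErgodic ρ} := by
  let κ : Kernel (StatProc A) (ℕ → A) := ⟨StatProc.law, measurable_law⟩
  have : IsMarkovKernel κ := ⟨fun ρ => inferInstanceAs (IsProbabilityMeasure ρ.law)⟩
  have hm : MeasurableSet {z : StatProc A × (ℕ → A) | ¬ FreqTendsto z.2 z.1.prob} := by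
    have : {z : StatProc A × (ℕ → A) | ¬ FreqTendsto z.2 z.1.prob} =
        ⋃ B, {z | Tendsto (fun n => freq (window z.2 0 n) B - z.1.prob B) atTop (𝓝 0)}ᶜ := by
      ext z
      simp [freqTendsto_iff, tendsto_sub_nhds_zero_iff]
    rw [this]
    exact MeasurableSet.iUnion fun B => (measurableSet_tendsto _ fun n =>
      ((measurable_comp_window 0 n fun X => freq X B).comp measurable_snd).sub
        ((measurable_prob B).comp measurable_fst)).compl
  have := (Kernel.measurable_kernel_prodMk_left (κ := κ) hm) (measurableSet_singleton 0)
  convert this using 1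
  ext ρ
  rw [Set.mem_ofPred_eq, isErgodic_iff]
  rfl

lemma ae_freqTendsto_condWord (ρ : StatProc A) :
    ∀ᵐ x ∂ρ.law, FreqTendsto x fun B => condWord ρ B x := by
  simp only [freqTendsto_iff]
  refine ae_all_iff.2 fun B => ?_
  have h := ae_tendsto_birkhoffAverage ρ.measurePreserving
    (measurable_one.indicator (measurableSet_wordSet B) : Measurable ((wordSet B).indicator
      (1 : (ℕ → A) → ℝ))) (C := 1) (fun x => by
        by_cases hx : x ∈ wordSet B <;> simp [hx])
  filter_upwards [h] with x hx
  have hlim : Tendsto (fun n : ℕ => n - B.length + 1) atTop atTop :=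
    tendsto_atTop_mono (fun n => by omega) (tendsto_sub_atTop_nat B.length)
  refine (hx.comp hlim).congr' ?_
  filter_upwards [eventually_ge_atTop B.length] with n hn
  exact (freq_window_eq_birkhoffAverage x hn).symm

/-- A function that is measurable for the conditioning σ-algebra is almost surely constant for
almost every conditional measure. -/
lemma ae_ae_condExpKernel_eq {Ω : Type*} {m mΩ : MeasurableSpace Ω} [StandardBorelSpace Ω]
    (hm : m ≤ mΩ) (μ : Measure Ω) [IsFiniteMeasure μ] {f : Ω → ℝ} (hf : Measurable[m] f) :
    ∀ᵐ x ∂μ, ∀ᵐ y ∂(condExpKernel μ m x), f x = f y := by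
  have h1 := hf.comp (@measurable_fst Ω Ω m mΩ)
  have h2 := (hf.mono hm le_rfl).comp (@measurable_snd Ω Ω m mΩ)
  have hdiag : @Measurable _ _ _ (@Prod.instMeasurableSpace Ω Ω m mΩ) (Function.diag : Ω → _) :=
    Measurable.prodMk (measurable_id'' hm) measurable_id
  have h : ∀ᵐ z ∂((μ.trim hm) ⊗ₘ condExpKernel μ m), f z.1 = f z.2 := by
    rw [compProd_trim_condExpKernel hm]
    refine (ae_map_iff
      (@Measurable.aemeasurable _ _ _ (@Prod.instMeasurableSpace Ω Ω m mΩ) _ _ hdiag)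
      ((h1.prodMk h2) measurableSet_diagonal)).2 (Eventually.of_forall fun x => rfl)
  exact ae_of_ae_trim hm (Measure.ae_ae_of_ae_compProd h)

/-- Existence of the ergodic decomposition: it is the law of the regular conditional probability
given the shift-invariant events. By the pointwise ergodic theorem the word frequencies tend to the
conditional probabilities of the words, which are invariant, hence constant almost surely for
almost every conditional measure. -/
theorem exists_isErgodicDecomposition (ρ : StatProc A) :
    ∃ W : Measure (StatProc A), IsErgodicDecomposition W ρ := by
  have hI := MeasurableSpace.invariants_le (α := ℕ → A) shift
  have hρ : IsProbabilityMeasure ρ.law := inferInstance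
  let κ : (ℕ → A) → Measure (ℕ → A) := condExpKernel ρ.law (MeasurableSpace.invariants shift)
  have hκp : ∀ x, IsProbabilityMeasure (κ x) := fun x => by dsimp only [κ]; infer_instance
  have hκI : Measurable[MeasurableSpace.invariants shift] κ :=
    (condExpKernel ρ.law (MeasurableSpace.invariants shift)).measurable
  have hκm : Measurable κ := hκI.mono hI le_rfl
  have hcond : ∀ᵐ x ∂ρ.law, ∀ B, (κ x).real (wordSet B) = condWord ρ B x :=
    ae_all_iff.2 fun B => condExpKernel_ae_eq_condExp hI (measurableSet_wordSet B)
  have hcond' : ∀ᵐ x ∂ρ.law, ∀ B, (κ x).real (shift ⁻¹' wordSet B) = condWord ρ B x :=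
    ae_all_iff.2 fun B => (condExpKernel_ae_eq_condExp hI
      (measurable_shift (measurableSet_wordSet B))).trans
        (condExp_indicator_preimage_shift ρ (measurableSet_wordSet B))
  let S : Set (ℕ → A) := {x | ∀ B, κ x (shift ⁻¹' wordSet B) = κ x (wordSet B)}
  have hSm : MeasurableSet S := by
    have : S = ⋂ B, {x | κ x (shift ⁻¹' wordSet B) = κ x (wordSet B)} := by
      ext x; simp [S]
    rw [this]
    exact MeasurableSet.iInter fun B => measurableSet_eq_fun
      ((Measure.measurable_coe (measurable_shift (measurableSet_wordSet B))).comp hκm)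
      ((Measure.measurable_coe (measurableSet_wordSet B)).comp hκm)
  have hS : ∀ᵐ x ∂ρ.law, x ∈ S := by
    filter_upwards [hcond, hcond'] with x h1 h2 B
    exact (measureReal_eq_measureReal_iff).1 ((h2 B).trans (h1 B).symm)
  -- On the null set where the conditional measure is not stationary, `ρ` itself is used.
  classical
  let m : (ℕ → A) → Measure (ℕ → A) := fun x => if x ∈ S then κ x else ρ.law
  have hmm : Measurable m := Measurable.ite hSm hκm measurable_const
  have hmp : ∀ x, IsProbabilityMeasure (m x) := fun x => by
    by_cases hx : x ∈ S
    · simpa only [m, if_pos hx] using hκp x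
    · simpa only [m, if_neg hx] using hρ
  have hms : ∀ x, IsStationary (⟨m x, hmp x⟩ : ProbabilityMeasure (ℕ → A)) := fun x => by
    refine (isStationary_iff_map_shift _).2 ?_
    change (m x).map shift = m x
    by_cases hx : x ∈ S
    · simp only [m, if_pos hx]
      refine measure_ext_of_wordSet 0 fun B _ => ?_
      rw [Measure.map_apply measurable_shift (measurableSet_wordSet B)]
      exact hx B
    · simp only [m, if_neg hx]
      exact ρ.measurePreserving.map_eq
  let g : (ℕ → A) → StatProc A := fun x => ⟨⟨m x, hmp x⟩, hms x⟩
  have hg : Measurable g := (hmm.subtype_mk).subtype_mk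
  have hgκ : ∀ᵐ x ∂ρ.law, (g x).law = κ x := by
    filter_upwards [hS] with x hx
    exact if_pos hx
  refine ⟨ρ.law.map g, ⟨Measure.isProbabilityMeasure_map hg.aemeasurable, ?_, ?_⟩⟩
  · rw [ae_map_iff hg.aemeasurable measurableSet_isErgodic]
    have h1 : ∀ᵐ x ∂ρ.law, ∀ᵐ y ∂(κ x), FreqTendsto y fun B => condWord ρ B y := by
      have h := ae_freqTendsto_condWord ρ
      rw [← condExpKernel_comp_trim (μ := ρ.law) hI] at h
      exact ae_of_ae_trim hI (Measure.ae_ae_of_ae_comp h)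
    have h2 : ∀ᵐ x ∂ρ.law, ∀ᵐ y ∂(κ x), ∀ B, condWord ρ B x = condWord ρ B y := by
      filter_upwards [ae_all_iff.2 fun B =>
        ae_ae_condExpKernel_eq hI ρ.law (measurable_condWord ρ B)] with x hx
      exact ae_all_iff.2 hx
    filter_upwards [h1, h2, hcond, hgκ] with x h1 h2 h3 h4
    rw [isErgodic_iff, h4]
    have hprob : (g x).prob = fun B => condWord ρ B x := by
      funext B
      rw [StatProc.prob_eq, h4, h3]
    filter_upwards [h1, h2] with y h5 h6
    rw [hprob]
    simpa only [h6] using h5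
  · intro E hE
    rw [lintegral_map (f := fun μ : StatProc A => μ.law E)
        ((Measure.measurable_coe hE).comp measurable_law) hg,
      lintegral_congr_ae (g := fun x => κ x E) (hgκ.mono fun x hx => by simp only [hx]),
      ← lintegral_trim hI (f := fun x => κ x E) ((Measure.measurable_coe hE).comp hκI)]
    conv_lhs => rw [← condExpKernel_comp_trim (μ := ρ.law) hI]
    rw [Measure.bind_apply hE]
    exact hκI.aemeasurable

/-- The ergodic decomposition of an ergodic process is the point mass at it. -/
lemma ae_eq_of_isErgodicDecomposition_of_isErgodic {W : Measure (StatProc A)} {ρ : StatProc A}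
    (h : IsErgodicDecomposition W ρ) (hρ : IsErgodic ρ) : ∀ᵐ μ ∂W, μ = ρ := by
  have hm : MeasurableSet {x : ℕ → A | FreqTendsto x ρ.prob} :=
    measurableSet_tendsto _ measurable_freq
  have h0 := h.mixture _ hm.compl
  have hz : ρ.law {x : ℕ → A | FreqTendsto x ρ.prob}ᶜ = 0 := isErgodic_iff.1 hρ
  rw [hz] at h0
  have h1 := (lintegral_eq_zero_iff
    ((Measure.measurable_coe hm.compl).comp measurable_law)).1 h0.symm
  filter_upwards [h1, h.ergodic] with μ h2 h3
  have h4 : ∀ᵐ x ∂μ.law, FreqTendsto x ρ.prob := h2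
  have : IsProbabilityMeasure μ.law := inferInstance
  obtain ⟨x, h5, h6⟩ := (h4.and (isErgodic_iff.1 h3)).exists
  have := h6.unique h5
  exact StatProc.ext_of_prob 0 fun B _ => congrFun this B

lemma closedUnderErgodicDecomposition_of_isErgodic {H : Set (StatProc A)}
    (hH : ∀ ρ ∈ H, IsErgodic ρ) : ClosedUnderErgodicDecomposition H := by
  intro ρ hρ W hW
  filter_upwards [ae_eq_of_isErgodicDecomposition_of_isErgodic hW (hH ρ hρ)] with μ hμ
  rwa [hμ]

end Decomposition

/-! ### Separation of convex sets of probability vectors -/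

section Separation

open scoped Pointwise

variable {ι : Type*} [Fintype ι]

/-- Two convex sets at `ℓ¹`-distance at least `r` are separated, with the same margin, by a
function with values in `[-1, 1]`. -/
lemma exists_separating_function {C₀ C₁ : Set (ι → ℝ)} (h₀ : Convex ℝ C₀) (h₁ : Convex ℝ C₁)
    {r : ℝ} (hr : 0 < r) (h : ∀ P ∈ C₀, ∀ Q ∈ C₁, r ≤ ∑ i, |P i - Q i|) :
    ∃ g : ι → ℝ, (∀ i, |g i| ≤ 1) ∧ ∀ P ∈ C₀, ∀ Q ∈ C₁, r ≤ ∑ i, g i * (P i - Q i) := by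
  classical
  set S : Set (ι → ℝ) := {v | ∑ i, |v i| < r} with hS
  have hSo : IsOpen S := isOpen_lt (by fun_prop) continuous_const
  have hSc : Convex ℝ S := by
    intro x hx y hy a b ha hb hab
    calc ∑ i, |(a • x + b • y) i| ≤ ∑ i, (a * |x i| + b * |y i|) :=
          Finset.sum_le_sum fun i _ => by
            simpa [abs_mul, abs_of_nonneg ha, abs_of_nonneg hb] using
              abs_add_le (a * x i) (b * y i)
      _ = a * ∑ i, |x i| + b * ∑ i, |y i| := by
          rw [Finset.sum_add_distrib, Finset.mul_sum, Finset.mul_sum]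
      _ < r := by
          have hx' : ∑ i, |x i| < r := hx
          have hy' : ∑ i, |y i| < r := hy
          rcases ha.eq_or_lt with rfl | ha'
          · have : b = 1 := by linarith
            subst this
            linarith
          · have h1 := mul_lt_mul_of_pos_left hx' ha'
            have h2 := mul_le_mul_of_nonneg_left hy'.le hb
            have h3 : a * r + b * r = r := by rw [← add_mul, hab, one_mul]
            linarith
  have hdisj : Disjoint S (C₀ - C₁) := by
    refine Set.disjoint_left.2 ?_
    rintro v hv ⟨P, hP, Q, hQ, rfl⟩
    exact absurd (h P hP Q hQ) (not_le.2 hv)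
  obtain ⟨L, u, hLS, hLC⟩ := geometric_hahn_banach_open hSc hSo (h₀.sub h₁) hdisj
  have hu : 0 < u := by simpa using hLS 0 (by simpa [hS] using hr)
  set e : ι → ℝ := fun i => L (Pi.single i 1) with he
  have hL : ∀ v : ι → ℝ, L v = ∑ i, e i * v i := fun v => by
    conv_lhs => rw [pi_eq_sum_univ' v, map_sum]
    refine Finset.sum_congr rfl fun i _ => ?_
    rw [map_smul, smul_eq_mul, mul_comm]
  have hbound : ∀ i, r * |e i| ≤ u := by
    intro i
    refine le_of_forall_lt_imp_le_of_dense fun c hc => ?_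
    rcases le_or_gt c 0 with hc0 | hc0
    · exact hc0.trans hu.le
    have hei : 0 < |e i| := by
      by_contra hcon
      have : |e i| = 0 := le_antisymm (not_lt.1 hcon) (abs_nonneg _)
      rw [this, mul_zero] at hc
      linarith
    -- Test the functional on a multiple of a coordinate vector inside the open `ℓ¹`-ball.
    set t : ℝ := c / |e i| with ht
    have htr : t < r := (div_lt_iff₀ hei).2 hc
    have ht0 : 0 < t := div_pos hc0 hei
    have hmem : ∀ s : ℝ, |s| = t → (Pi.single i s : ι → ℝ) ∈ S := by
      intro s hs
      have : ∑ j, |(Pi.single i s : ι → ℝ) j| = t := by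
        rw [Finset.sum_eq_single i]
        · simpa using hs
        · intro j _ hj; simp [hj]
        · simp
      rw [hS, Set.mem_ofPred_eq, this]
      exact htr
    have hval : ∀ s : ℝ, L (Pi.single i s) = e i * s := by
      intro s
      rw [hL, Finset.sum_eq_single i]
      · simp
      · intro j _ hj; simp [hj]
      · simp
    have hct : c = |e i| * t := by rw [ht]; field_simp
    rcases abs_cases (e i) with ⟨h1, -⟩ | ⟨h1, -⟩
    · have := hLS _ (hmem t (abs_of_pos ht0))
      rw [hval] at this
      rw [hct, h1]; exact this.le
    · have := hLS _ (hmem (-t) (by rw [abs_neg, abs_of_pos ht0]))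
      rw [hval] at this
      rw [hct, h1]; linarith
  refine ⟨fun i => r / u * e i, fun i => ?_, fun P hP Q hQ => ?_⟩
  · rw [abs_mul, abs_of_pos (div_pos hr hu), div_mul_eq_mul_div, div_le_one hu]
    exact hbound i
  · have h1 : u ≤ L (P - Q) := hLC _ ⟨P, hP, Q, hQ, rfl⟩
    rw [hL] at h1
    have h2 : ∑ i, r / u * e i * (P i - Q i) = r / u * ∑ i, e i * (P - Q) i := by
      rw [Finset.mul_sum]
      exact Finset.sum_congr rfl fun i _ => by rw [Pi.sub_apply]; ring
    rw [h2]
    calc r = r / u * u := by field_simp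
      _ ≤ _ := mul_le_mul_of_nonneg_left h1 (div_pos hr hu).le

open scoped Classical in
/-- Two convex sets of probability vectors that are almost mutually singular are told apart by a
single event. -/
lemma exists_separating_event {C₀ C₁ : Set (ι → ℝ)} (h₀ : Convex ℝ C₀) (h₁ : Convex ℝ C₁)
    (hs₀ : C₀ ⊆ stdSimplex ℝ ι) (hs₁ : C₁ ⊆ stdSimplex ℝ ι) (hn₀ : C₀.Nonempty)
    (hn₁ : C₁.Nonempty) {ε : ℝ} (hε : ε < 2)
    (h : ∀ P ∈ C₀, ∀ Q ∈ C₁, 2 - ε ≤ ∑ i, |P i - Q i|) :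
    ∃ D : Set ι, (∀ P ∈ C₀, ∑ i, (if i ∈ D then 0 else P i) ≤ ε) ∧
      ∀ Q ∈ C₁, ∑ i, (if i ∈ D then Q i else 0) ≤ ε := by
  obtain ⟨g, hg, hsep⟩ := exists_separating_function h₀ h₁ (by linarith : 0 < 2 - ε) h
  have hlow : ∀ P ∈ stdSimplex ℝ ι, -1 ≤ ∑ i, g i * P i ∧ ∑ i, g i * P i ≤ 1 := by
    intro P hP
    have h1 : ∑ i, |g i * P i| ≤ 1 := by
      rw [← hP.2]
      refine Finset.sum_le_sum fun i _ => ?_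
      rw [abs_mul, abs_of_nonneg (hP.1 i)]
      exact mul_le_of_le_one_left (hP.1 i) (hg i)
    exact abs_le.1 ((Finset.abs_sum_le_sum_abs _ _).trans h1)
  have hsep' : ∀ P ∈ C₀, ∀ Q ∈ C₁, 2 - ε ≤ ∑ i, g i * P i - ∑ i, g i * Q i := by
    intro P hP Q hQ
    rw [← Finset.sum_sub_distrib]
    simpa only [mul_sub] using hsep P hP Q hQ
  refine ⟨{i | 0 < g i}, fun P hP => ?_, fun Q hQ => ?_⟩
  · obtain ⟨Q, hQ⟩ := hn₁
    have h1 := hsep' P hP Q hQ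
    have h2 := (hlow Q (hs₁ hQ)).1
    have h3 : ∑ i, (if i ∈ {i | 0 < g i} then 0 else P i) ≤
        ∑ i, (P i - g i * P i) := by
      refine Finset.sum_le_sum fun i _ => ?_
      have hp := (hs₀ hP).1 i
      have := (abs_le.1 (hg i)).2
      simp only [Set.mem_ofPred_eq]
      split_ifs with hi <;> nlinarith
    rw [Finset.sum_sub_distrib, (hs₀ hP).2] at h3
    linarith
  · obtain ⟨P, hP⟩ := hn₀
    have h1 := hsep' P hP Q hQ
    have h2 := (hlow P (hs₀ hP)).2
    have h3 : ∑ i, (if i ∈ {i | 0 < g i} then Q i else 0) ≤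
        ∑ i, (Q i + g i * Q i) := by
      refine Finset.sum_le_sum fun i _ => ?_
      have hp := (hs₁ hQ).1 i
      have := (abs_le.1 (hg i)).1
      simp only [Set.mem_ofPred_eq]
      split_ifs with hi <;> nlinarith
    rw [Finset.sum_add_distrib, (hs₁ hQ).2] at h3
    linarith

end Separation

/-! ### Mutually singular measures on sequences -/

section Singular

variable {A : Type*} [Fintype A] [MeasurableSpace A] [DiscreteMeasurableSpace A]

open scoped Classical in
lemma measureReal_window_mem (P : Measure (ℕ → A)) [IsFiniteMeasure P] (n : ℕ)
    (D : Set (List A)) :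
    P.real {x | window x 0 n ∈ D} =
      ∑ b : Fin n → A, if List.ofFn b ∈ D then P.real (wordSet (List.ofFn b)) else 0 := by
  rw [← Finset.sum_filter, ← measureReal_biUnion_finset]
  · congr 1
    ext x
    simp only [Set.mem_ofPred_eq, Finset.mem_filter, Finset.mem_univ, true_and, Set.mem_iUnion,
      exists_prop, wordSet, List.length_ofFn]
    constructor
    · intro h
      exact ⟨fun i => x (0 + i), h, rfl⟩
    · rintro ⟨b, hb, hx⟩
      rwa [hx]
  · intro b _ c _ hbc
    refine Set.disjoint_left.2 fun x h1 h2 => hbc ?_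
    simp only [wordSet, List.length_ofFn, Set.mem_ofPred_eq] at h1 h2
    exact List.ofFn_inj.1 (h1.symm.trans h2)
  · exact fun b _ => measurableSet_wordSet _

/-- Every event is approximated by events that depend on finitely many letters. -/
lemma measure_symmDiff_window_lt (P : Measure (ℕ → A)) [IsFiniteMeasure P] {G : Set (ℕ → A)}
    (hG : MeasurableSet G) {δ : ENNReal} (hδ : 0 < δ) :
    ∃ (n : ℕ) (D : Set (List A)), P (symmDiff {x | window x 0 n ∈ D} G) < δ := by
  let C : Set (Set (ℕ → A)) := {s | ∃ (n : ℕ) (D : Set (List A)), s = {x | window x 0 n ∈ D}}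
  have hlift : ∀ {m n : ℕ} (D : Set (List A)), m ≤ n →
      {x : ℕ → A | window x 0 m ∈ D} = {x | window x 0 n ∈ {L | L.take m ∈ D}} := by
    intro m n D h
    ext x
    simp [take_window x h]
  have hC : IsSetRing C := by
    refine ⟨⟨0, ∅, by simp⟩, ?_, ?_⟩
    · rintro _ _ ⟨m, D, rfl⟩ ⟨n, E, rfl⟩
      rw [hlift D (le_max_left m n), hlift E (le_max_right m n)]
      exact ⟨max m n, {L | L.take m ∈ D} ∪ {L | L.take n ∈ E}, rfl⟩
    · rintro _ _ ⟨m, D, rfl⟩ ⟨n, E, rfl⟩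
      rw [hlift D (le_max_left m n), hlift E (le_max_right m n)]
      exact ⟨max m n, {L | L.take m ∈ D} \ {L | L.take n ∈ E}, rfl⟩
  have hgen : (inferInstance : MeasurableSpace (ℕ → A)) = MeasurableSpace.generateFrom C := by
    apply le_antisymm
    · rw [generateFrom_wordSet]
      refine MeasurableSpace.generateFrom_mono ?_
      rintro _ ⟨B, rfl⟩
      exact ⟨B.length, {B}, rfl⟩
    · refine MeasurableSpace.generateFrom_le ?_
      rintro _ ⟨n, D, rfl⟩
      exact measurableSet_window 0 n D
  obtain ⟨t, ⟨n, D, rfl⟩, ht⟩ := exists_measure_symmDiff_lt_of_generateFrom_isSetRing (μ := P) hC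
    ⟨{Set.univ}, Set.countable_singleton _, by
      rintro _ rfl
      exact ⟨0, Set.univ, by simp⟩, by simp⟩ hgen hG hδ
  exact ⟨n, D, ht⟩

/-- The total variation distance of the `n`-letter marginals of two mutually singular probability
measures tends to its largest possible value. -/
lemma exists_lt_sum_abs_sub {P Q : Measure (ℕ → A)} [IsProbabilityMeasure P]
    [IsProbabilityMeasure Q] {G : Set (ℕ → A)} (hG : MeasurableSet G) (hP : P Gᶜ = 0)
    (hQ : Q G = 0) {ε : ℝ} (hε : 0 < ε) :
    ∃ n, 2 - ε < ∑ b : Fin n → A,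
      |P.real (wordSet (List.ofFn b)) - Q.real (wordSet (List.ofFn b))| := by
  classical
  obtain ⟨n, D, hD⟩ := measure_symmDiff_window_lt (P + Q) hG
    (δ := ENNReal.ofReal (ε / 4)) (by simpa using hε)
  refine ⟨n, ?_⟩
  set t : Set (ℕ → A) := {x | window x 0 n ∈ D} with ht
  have htm : MeasurableSet t := measurableSet_window 0 n D
  rw [Measure.add_apply] at hD
  have hP1 : P.real tᶜ < ε / 4 := by
    have h1 : P tᶜ ≤ P (symmDiff t G) + P Gᶜ := by
      refine (measure_mono fun x hx => ?_).trans (measure_union_le _ _)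
      by_cases hxG : x ∈ G
      · exact Or.inl (Or.inr ⟨hxG, hx⟩)
      · exact Or.inr hxG
    rw [hP, add_zero] at h1
    refine (ENNReal.lt_ofReal_iff_toReal_lt (measure_ne_top _ _)).1 ?_
    exact (h1.trans le_self_add).trans_lt hD
  have hQ1 : Q.real t < ε / 4 := by
    have h1 : Q t ≤ Q (symmDiff t G) + Q G := by
      refine (measure_mono fun x hx => ?_).trans (measure_union_le _ _)
      by_cases hxG : x ∈ G
      · exact Or.inr hxG
      · exact Or.inl (Or.inl ⟨hx, hxG⟩)
    rw [hQ, add_zero] at h1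
    refine (ENNReal.lt_ofReal_iff_toReal_lt (measure_ne_top _ _)).1 ?_
    exact (h1.trans le_add_self).trans_lt hD
  have hcompl : tᶜ = {x : ℕ → A | window x 0 n ∈ Dᶜ} := rfl
  have e1 := measureReal_window_mem P n D
  have e2 := measureReal_window_mem Q n D
  have e3 := measureReal_window_mem P n Dᶜ
  have e4 := measureReal_window_mem Q n Dᶜ
  rw [← ht] at e1 e2
  rw [← hcompl] at e3 e4
  have f1 := measureReal_add_measureReal_compl (μ := P) htm
  have f2 := measureReal_add_measureReal_compl (μ := Q) htm
  rw [probReal_univ] at f1 f2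
  have key : (P.real t - Q.real t) + (Q.real tᶜ - P.real tᶜ) ≤ ∑ b : Fin n → A,
      |P.real (wordSet (List.ofFn b)) - Q.real (wordSet (List.ofFn b))| := by
    rw [e1, e2, e3, e4, ← Finset.sum_sub_distrib, ← Finset.sum_sub_distrib,
      ← Finset.sum_add_distrib]
    refine Finset.sum_le_sum fun b _ => ?_
    have h1 := le_abs_self (P.real (wordSet (List.ofFn b)) - Q.real (wordSet (List.ofFn b)))
    have h2 := neg_abs_le (P.real (wordSet (List.ofFn b)) - Q.real (wordSet (List.ofFn b)))
    by_cases hb : List.ofFn b ∈ D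
    · simp only [hb, Set.mem_compl_iff, not_true_eq_false, if_true, if_false]
      linarith
    · simp only [hb, Set.mem_compl_iff, not_false_eq_true, if_true, if_false]
      linarith
  linarith

end Singular

/-! ### Mixtures of a compact family of stationary processes -/

section Mixtures

variable {A : Type*}

lemma ofFn_snoc {n : ℕ} (b : Fin n → A) (a : A) :
    List.ofFn (Fin.snoc b a : Fin (n + 1) → A) = List.ofFn b ++ [a] := by
  rw [List.ofFn_succ', List.concat_eq_append]
  simp

lemma sum_snoc [Fintype A] {M : Type*} [AddCommMonoid M] {n : ℕ} (f : (Fin (n + 1) → A) → M) :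
    ∑ b, f b = ∑ b : Fin n → A, ∑ a, f (Fin.snoc b a) := by
  rw [← (Fin.snocEquiv fun _ : Fin (n + 1) => A).sum_comp, Fintype.sum_prod_type_right]
  rfl

variable {V : Set (List A → ℝ)}

/-- The probabilities of the words of length `n` under the mixture of a family of processes, given
by their word probabilities, according to `η`. -/
noncomputable def mixtureMarginal (n : ℕ) (η : Measure V) (b : Fin n → A) : ℝ :=
  ∫ v, v.1 (List.ofFn b) ∂η

lemma measurable_law_comp [MeasurableSpace A] [DiscreteMeasurableSpace A] [Finite A]
    {f : V → StatProc A} (hf : ∀ v, (f v).prob = v.1) : Measurable fun v => (f v).law := by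
  refine Measurable.measure_of_isPiSystem_of_isProbabilityMeasure generateFrom_wordSet
    isPiSystem_wordSet ?_
  rintro _ ⟨B, rfl⟩
  have : (fun v : V => (f v).law (wordSet B)) = fun v : V => ENNReal.ofReal (v.1 B) := by
    funext v
    rw [← hf, StatProc.prob_eq, ofReal_measureReal]
  rw [this]
  exact ((measurable_pi_apply B).comp measurable_subtype_coe).ennreal_ofReal

/-- The mixture of a family of processes as a measure on sequences. -/
lemma exists_mixture [MeasurableSpace A] [DiscreteMeasurableSpace A] [Finite A]
    {f : V → StatProc A} (hf : ∀ v, (f v).prob = v.1) (η : Measure V) [IsProbabilityMeasure η] :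
    ∃ P : Measure (ℕ → A), IsProbabilityMeasure P ∧
      (∀ (n : ℕ) (b : Fin n → A), P.real (wordSet (List.ofFn b)) = mixtureMarginal n η b) ∧
      ∀ E, MeasurableSet E → (∀ v, (f v).law E = 0) → P E = 0 := by
  have hm := measurable_law_comp hf
  have hb : ∀ E, MeasurableSet E → η.bind (fun v => (f v).law) E = ∫⁻ v, (f v).law E ∂η :=
    fun E hE => Measure.bind_apply hE hm.aemeasurable
  refine ⟨η.bind fun v => (f v).law, ⟨?_⟩, fun n b => ?_, fun E hE h0 => ?_⟩
  · rw [hb _ MeasurableSet.univ]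
    simp
  · rw [Measure.real, hb _ (measurableSet_wordSet _), mixtureMarginal,
      ← integral_toReal (f := fun v => (f v).law (wordSet (List.ofFn b)))
        ((Measure.measurable_coe (measurableSet_wordSet _)).comp hm).aemeasurable
        (Eventually.of_forall fun v => measure_lt_top _ _)]
    congr 1
    funext v
    rw [← hf]
    rfl
  · rw [hb E hE]
    simp [h0]

variable [Fintype A] [CompactSpace V]

lemma integrable_word (η : Measure V) [IsFiniteMeasure η] (B : List A) :
    Integrable (fun v : V => v.1 B) η :=
  (BoundedContinuousFunction.mkOfCompact
    ⟨fun v : V => v.1 B, (continuous_apply B).comp continuous_subtype_val⟩).integrable η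

lemma continuous_mixtureMarginal (n : ℕ) (b : Fin n → A) :
    Continuous fun η : ProbabilityMeasure V => mixtureMarginal n (η : Measure V) b :=
  ProbabilityMeasure.continuous_integral_boundedContinuousFunction
    (BoundedContinuousFunction.mkOfCompact ⟨fun v : V => v.1 (List.ofFn b),
      (continuous_apply (List.ofFn b)).comp continuous_subtype_val⟩)

/-- The set of `n`-letter marginals of mixtures. -/
def mixtureMarginals (n : ℕ) (V : Set (List A → ℝ)) : Set ((Fin n → A) → ℝ) :=
  Set.range fun η : ProbabilityMeasure V => mixtureMarginal n (η : Measure V)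

lemma convex_mixtureMarginals (n : ℕ) : Convex ℝ (mixtureMarginals n V) := by
  rintro _ ⟨η, rfl⟩ _ ⟨θ, rfl⟩ a b ha hb hab
  let ξ : Measure V := ENNReal.ofReal a • (η : Measure V) + ENNReal.ofReal b • (θ : Measure V)
  have hξ : IsProbabilityMeasure ξ := ⟨by
    simp [ξ, ← ENNReal.ofReal_add ha hb, hab]⟩
  refine ⟨⟨ξ, hξ⟩, ?_⟩
  funext c
  change ∫ v, v.1 (List.ofFn c) ∂ξ = _
  rw [integral_add_measure ((integrable_word _ _).smul_measure ENNReal.ofReal_ne_top)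
    ((integrable_word _ _).smul_measure ENNReal.ofReal_ne_top), integral_smul_measure,
    integral_smul_measure, ENNReal.toReal_ofReal ha, ENNReal.toReal_ofReal hb]
  rfl

variable [MeasurableSpace A] [DiscreteMeasurableSpace A] {f : V → StatProc A}

lemma mixtureMarginal_eq_sum (hf : ∀ v, (f v).prob = v.1) {n : ℕ} (η : Measure V)
    [IsFiniteMeasure η] (b : Fin n → A) :
    mixtureMarginal n η b = ∑ a, mixtureMarginal (n + 1) η (Fin.snoc b a) := by
  simp only [mixtureMarginal]
  rw [← integral_finsetSum _ fun a _ => integrable_word _ _]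
  congr 1
  funext v
  simp only [ofFn_snoc, ← hf]
  exact ((f v).sum_prob_concat _).symm

lemma mixtureMarginals_subset_stdSimplex (hf : ∀ v, (f v).prob = v.1) (n : ℕ) :
    mixtureMarginals n V ⊆ stdSimplex ℝ (Fin n → A) := by
  rintro _ ⟨η, rfl⟩
  refine ⟨fun b => integral_nonneg fun v => ?_, ?_⟩
  · rw [← hf]
    exact (f v).prob_nonneg _
  · induction n with
    | zero =>
      simp only [mixtureMarginal, List.ofFn_zero, ← hf]
      simp [StatProc.prob_eq]
    | succ n ih =>
      rw [sum_snoc, ← ih]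
      exact Finset.sum_congr rfl fun b _ => (mixtureMarginal_eq_sum hf _ b).symm

end Mixtures

/-! ### Sequences whose word frequencies converge to a given set -/

section Generic

variable {A : Type*} [DecidableEq A]

/-- The sequences whose word frequencies converge to a point of `V`. -/
def freqLimitIn (V : Set (List A → ℝ)) : Set (ℕ → A) := {x | ∃ l ∈ V, FreqTendsto x l}

lemma disjoint_freqLimitIn {V₀ V₁ : Set (List A → ℝ)} (h : Disjoint V₀ V₁) :
    Disjoint (freqLimitIn V₀) (freqLimitIn V₁) := by
  refine Set.disjoint_left.2 ?_
  rintro x ⟨l, hl, hx⟩ ⟨l', hl', hx'⟩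
  rw [hx.unique hx'] at hl
  exact Set.disjoint_left.1 h hl hl'

variable [Fintype A] [MeasurableSpace A] [DiscreteMeasurableSpace A]

lemma measurableSet_freqLimitIn {V : Set (List A → ℝ)} (hV : IsClosed V) :
    MeasurableSet (freqLimitIn V) := by
  classical
  set C : Set (ℕ → A) := {x | ∃ l, FreqTendsto x l} with hC
  have hCm : MeasurableSet C := measurableSet_exists_tendsto measurable_freq
  let F : (ℕ → A) → List A → ℝ := fun x => if h : x ∈ C then h.choose else 0
  have hF : ∀ x ∈ C, FreqTendsto x (F x) := fun x hx => by
    simp only [F, dif_pos hx]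
    exact hx.choose_spec
  have hFm : Measurable F := by
    refine measurable_of_tendsto_metrizable
      (f := fun n x => if x ∈ C then fun B => freq (window x 0 n) B else 0)
      (fun n => Measurable.ite hCm (measurable_freq n) measurable_const) ?_
    refine tendsto_pi_nhds.2 fun x => ?_
    by_cases hx : x ∈ C
    · simp only [if_pos hx]
      exact hF x hx
    · simp only [if_neg hx, F, dif_neg hx]
      exact tendsto_const_nhds
  have : freqLimitIn V = C ∩ F ⁻¹' V := by
    ext x
    constructor
    · rintro ⟨l, hl, hx⟩
      have hxC : x ∈ C := ⟨l, hx⟩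
      refine ⟨hxC, ?_⟩
      rwa [Set.mem_preimage, (hF x hxC).unique hx]
    · rintro ⟨hx, hxV⟩
      exact ⟨F x, hxV, hF x hx⟩
  rw [this]
  exact hCm.inter (hFm hV.measurableSet)

/-- If `H` is closed under ergodic decompositions, then the word frequencies of a process in `H`
converge almost surely to the word probabilities of some process in `H`. -/
lemma measure_compl_freqLimitIn {H : Set (StatProc A)} (hH : ClosedUnderErgodicDecomposition H)
    (hV : IsClosed (StatProc.prob '' H)) {ρ : StatProc A} (hρ : ρ ∈ H) :
    ρ.law (freqLimitIn (StatProc.prob '' H))ᶜ = 0 := by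
  obtain ⟨W, hW⟩ := exists_isErgodicDecomposition ρ
  rw [hW.mixture _ (measurableSet_freqLimitIn hV).compl, lintegral_eq_zero_iff
    (f := fun μ : StatProc A => μ.law (freqLimitIn (StatProc.prob '' H))ᶜ)
    ((Measure.measurable_coe (measurableSet_freqLimitIn hV).compl).comp measurable_law)]
  filter_upwards [hH ρ hρ W hW, hW.ergodic] with μ h1 h2
  have h3 : ∀ᵐ x ∂μ.law, x ∈ freqLimitIn (StatProc.prob '' H) := by
    filter_upwards [isErgodic_iff.1 h2] with x hx
    exact ⟨μ.prob, ⟨μ, h1, rfl⟩, hx⟩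
  exact h3

end Generic

/-! ### Existence of uniformly consistent tests -/

section Tests

variable {A : Type*} [Fintype A] [DecidableEq A] [MeasurableSpace A] [DiscreteMeasurableSpace A]

/-- By compactness, the mixtures of two disjoint compact sets that are closed under ergodic
decompositions have almost mutually singular marginals on words of some fixed length. -/
lemma exists_forall_lt_sum_abs_mixtureMarginal {H₀ H₁ : Set (StatProc A)} (hdisj : Disjoint H₀ H₁)
    (hV₀ : IsCompact (StatProc.prob '' H₀)) (hV₁ : IsCompact (StatProc.prob '' H₁))
    (he₀ : ClosedUnderErgodicDecomposition H₀) (he₁ : ClosedUnderErgodicDecomposition H₁)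
    {ε : ℝ} (hε : 0 < ε) :
    ∃ n, ∀ P ∈ mixtureMarginals n (StatProc.prob '' H₀),
      ∀ Q ∈ mixtureMarginals n (StatProc.prob '' H₁), 2 - ε ≤ ∑ b, |P b - Q b| := by
  have : CompactSpace (StatProc.prob '' H₀) := isCompact_iff_compactSpace.1 hV₀
  have : CompactSpace (StatProc.prob '' H₁) := isCompact_iff_compactSpace.1 hV₁
  choose f₀ hf₀ using fun v : StatProc.prob '' H₀ => v.2
  choose f₁ hf₁ using fun v : StatProc.prob '' H₁ => v.2
  let d : ℕ → ProbabilityMeasure (StatProc.prob '' H₀) × ProbabilityMeasure (StatProc.prob '' H₁) →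
    ℝ := fun n z => ∑ b : Fin n → A,
      |mixtureMarginal n (z.1 : Measure (StatProc.prob '' H₀)) b -
        mixtureMarginal n (z.2 : Measure (StatProc.prob '' H₁)) b|
  have hd : ∀ n, Continuous (d n) := fun n => continuous_finsetSum _ fun b _ =>
    (((continuous_mixtureMarginal n b).comp continuous_fst).sub
      ((continuous_mixtureMarginal n b).comp continuous_snd)).abs
  have hmono : ∀ n z, d n z ≤ d (n + 1) z := fun n z => by
    simp only [d]
    rw [sum_snoc]
    refine Finset.sum_le_sum fun b _ => ?_
    rw [mixtureMarginal_eq_sum (fun v => (hf₀ v).2), mixtureMarginal_eq_sum (fun v => (hf₁ v).2),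
      ← Finset.sum_sub_distrib]
    exact Finset.abs_sum_le_sum_abs _ _
  by_contra! hcon
  have hne : (⋂ n, {z | d n z ≤ 2 - ε}).Nonempty := by
    refine IsCompact.nonempty_iInter_of_sequence_nonempty_isCompact_isClosed _
      (fun n z hz => (hmono n z).trans hz) (fun n => ?_)
      (isClosed_le (hd 0) continuous_const).isCompact
      (fun n => isClosed_le (hd n) continuous_const)
    obtain ⟨_, ⟨η, rfl⟩, _, ⟨θ, rfl⟩, h⟩ := hcon n
    exact ⟨(η, θ), h.le⟩
  obtain ⟨⟨η, θ⟩, hz⟩ := hne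
  obtain ⟨P, hP, hPm, hP0⟩ := exists_mixture (fun v => (hf₀ v).2) (η : Measure _)
  obtain ⟨Q, hQ, hQm, hQ0⟩ := exists_mixture (fun v => (hf₁ v).2) (θ : Measure _)
  have hm₀ := measurableSet_freqLimitIn hV₀.isClosed
  have hm₁ := measurableSet_freqLimitIn hV₁.isClosed
  have hVd : Disjoint (StatProc.prob '' H₀) (StatProc.prob '' H₁) := by
    refine Set.disjoint_left.2 ?_
    rintro _ ⟨ρ, hρ, rfl⟩ ⟨ρ', hρ', h⟩
    have : ρ' = ρ := StatProc.ext_of_prob 0 fun B _ => congrFun h B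
    exact Set.disjoint_left.1 hdisj hρ (this ▸ hρ')
  obtain ⟨n, hn⟩ := exists_lt_sum_abs_sub (P := P) (Q := Q) hm₀
    (hP0 _ hm₀.compl fun v => measure_compl_freqLimitIn he₀ hV₀.isClosed (hf₀ v).1)
    (hQ0 _ hm₀ fun v => measure_mono_null
      (Set.disjoint_left.1 (disjoint_freqLimitIn hVd) : _ ⊆ (freqLimitIn _)ᶜ)
      (measure_compl_freqLimitIn he₁ hV₁.isClosed (hf₁ v).1)) hε
  simp only [hPm, hQm] at hn
  exact absurd (Set.mem_iInter.1 hz n) (not_le.2 hn)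

/-- At every level there is a test, based on finitely many letters, with uniformly small errors. -/
lemma exists_test_of_level {H₀ H₁ : Set (StatProc A)} (hdisj : Disjoint H₀ H₁)
    (hV₀ : IsCompact (StatProc.prob '' H₀)) (hV₁ : IsCompact (StatProc.prob '' H₁))
    (he₀ : ClosedUnderErgodicDecomposition H₀) (he₁ : ClosedUnderErgodicDecomposition H₁)
    {ε : ℝ} (hε : 0 < ε) :
    ∃ (n : ℕ) (D : Set (List A)), (∀ ρ ∈ H₀, ρ.law.real {x | window x 0 n ∉ D} ≤ ε) ∧
      ∀ ρ ∈ H₁, ρ.law.real {x | window x 0 n ∈ D} ≤ ε := by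
  classical
  rcases H₀.eq_empty_or_nonempty with rfl | hne₀
  · exact ⟨0, ∅, by simp, fun ρ _ => by simpa using hε.le⟩
  rcases H₁.eq_empty_or_nonempty with rfl | hne₁
  · exact ⟨0, Set.univ, fun ρ _ => by simpa using hε.le, by simp⟩
  have : CompactSpace (StatProc.prob '' H₀) := isCompact_iff_compactSpace.1 hV₀
  have : CompactSpace (StatProc.prob '' H₁) := isCompact_iff_compactSpace.1 hV₁
  choose f₀ hf₀ using fun v : StatProc.prob '' H₀ => v.2
  choose f₁ hf₁ using fun v : StatProc.prob '' H₁ => v.2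
  obtain ⟨n, hn⟩ := exists_forall_lt_sum_abs_mixtureMarginal hdisj hV₀ hV₁ he₀ he₁
    (lt_min hε one_pos)
  have hdirac : ∀ {H : Set (StatProc A)}, ∀ ρ ∈ H,
      (fun b : Fin n → A => ρ.prob (List.ofFn b)) ∈ mixtureMarginals n (StatProc.prob '' H) := by
    intro H ρ hρ
    refine ⟨⟨Measure.dirac ⟨ρ.prob, ρ, hρ, rfl⟩, inferInstance⟩, ?_⟩
    funext b
    have hm : Measurable fun v : StatProc.prob '' H => v.1 (List.ofFn b) :=
      (measurable_pi_apply (List.ofFn b)).comp measurable_subtype_coe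
    exact integral_dirac' _ _ hm.stronglyMeasurable
  obtain ⟨ρ₀, hρ₀⟩ := hne₀
  obtain ⟨ρ₁, hρ₁⟩ := hne₁
  obtain ⟨D, hD₀, hD₁⟩ := exists_separating_event (convex_mixtureMarginals n)
    (convex_mixtureMarginals n) (mixtureMarginals_subset_stdSimplex (fun v => (hf₀ v).2) n)
    (mixtureMarginals_subset_stdSimplex (fun v => (hf₁ v).2) n) ⟨_, hdirac ρ₀ hρ₀⟩
    ⟨_, hdirac ρ₁ hρ₁⟩ ((min_le_right ε 1).trans_lt one_lt_two) hn
  have hmem : ∀ b : Fin n → A, List.ofFn b ∈ List.ofFn '' D ↔ b ∈ D := fun b =>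
    ⟨by rintro ⟨c, hc, h⟩; rwa [← List.ofFn_inj.1 h], fun h => ⟨b, h, rfl⟩⟩
  refine ⟨n, List.ofFn '' D, fun ρ hρ => ?_, fun ρ hρ => ?_⟩
  · have h := (hD₀ _ (hdirac ρ hρ)).trans (min_le_left ε 1)
    refine le_trans (le_of_eq ?_) h
    refine (measureReal_window_mem ρ.law n (List.ofFn '' D)ᶜ).trans
      (Finset.sum_congr rfl fun b _ => ?_)
    by_cases hb : b ∈ D
    · simp [hb]
    · simp [hb, StatProc.prob_eq]
  · have h := (hD₁ _ (hdirac ρ hρ)).trans (min_le_left ε 1)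
    refine le_trans (le_of_eq ?_) h
    refine (measureReal_window_mem ρ.law n (List.ofFn '' D)).trans
      (Finset.sum_congr rfl fun b _ => ?_)
    by_cases hb : b ∈ D
    · simp [hb, StatProc.prob_eq]
    · simp [hb]

/-- Two disjoint sets of stationary processes with compact sets of word probabilities that are
closed under ergodic decompositions are distinguished by a uniformly consistent test. -/
theorem exists_uniformlyConsistent {H₀ H₁ : Set (StatProc A)} (hdisj : Disjoint H₀ H₁)
    (hV₀ : IsCompact (StatProc.prob '' H₀)) (hV₁ : IsCompact (StatProc.prob '' H₁))
    (he₀ : ClosedUnderErgodicDecomposition H₀) (he₁ : ClosedUnderErgodicDecomposition H₁) :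
    ∃ φ : List A → Fin 2, UniformlyConsistent φ H₀ H₁ := by
  classical
  choose N D hD₀ hD₁ using fun k : ℕ => exists_test_of_level hdisj hV₀ hV₁ he₀ he₁
    (ε := 1 / ((k : ℝ) + 1)) (by positivity)
  -- On words of length `n` the most accurate available test among the first `n` is used.
  let K : ℕ → ℕ := fun n => Nat.findGreatest (fun k => N k ≤ n) n
  let φ : List A → Fin 2 := fun L => if L.take (N (K L.length)) ∈ D (K L.length) then 0 else 1
  refine ⟨φ, fun α hα => ?_⟩
  obtain ⟨k, hk⟩ := exists_nat_one_div_lt hα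
  refine ⟨max k (N k), fun n hn => ?_⟩
  have hkn : k ≤ n := (le_max_left _ _).trans hn
  have hNn : N k ≤ n := (le_max_right _ _).trans hn
  have hK : k ≤ K n := Nat.le_findGreatest hkn hNn
  have hNK : N (K n) ≤ n := Nat.findGreatest_spec (P := fun k => N k ≤ n) hkn hNn
  have hlt : 1 / ((K n : ℝ) + 1) < α := by
    refine lt_of_le_of_lt (one_div_le_one_div_of_le (by positivity) ?_) hk
    have : (k : ℝ) ≤ K n := Nat.cast_le.2 hK
    linarith
  have hφ : ∀ x : ℕ → A, φ (window x 0 n) = if window x 0 (N (K n)) ∈ D (K n) then 0 else 1 :=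
    fun x => by simp only [φ, length_window, take_window x hNK]
  constructor
  · intro ρ hρ
    refine lt_of_le_of_lt (le_of_eq ?_) ((hD₀ (K n) ρ hρ).trans_lt hlt)
    congr 1
    ext x
    simp [hφ]
  · intro ρ hρ
    refine lt_of_le_of_lt (le_of_eq ?_) ((hD₁ (K n) ρ hρ).trans_lt hlt)
    congr 1
    ext x
    simp [hφ]

end Tests

/-! ### The distributional distance -/

section Distance

variable {A : Type*} [MeasurableSpace A] {w : List A → ℝ}

lemma summable_distDist (hw_pos : ∀ B, 0 < w B) (hw_sum : Summable w) (ρ₁ ρ₂ : StatProc A) :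
    Summable fun B => w B * |ρ₁.prob B - ρ₂.prob B| := by
  refine Summable.of_nonneg_of_le (fun B => mul_nonneg (hw_pos B).le (abs_nonneg _))
    (fun B => ?_) hw_sum
  refine mul_le_of_le_one_right (hw_pos B).le ?_
  rw [abs_le]
  constructor <;> linarith [ρ₁.prob_nonneg B, ρ₁.prob_le_one B, ρ₂.prob_nonneg B, ρ₂.prob_le_one B]

/-- Continuity for the distributional distance is continuity of all word probabilities. -/
lemma distContinuous_iff (hw_pos : ∀ B, 0 < w B) (hw_sum : Summable w) {Θ : Type*}
    [TopologicalSpace Θ] {F : Θ → StatProc A} :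
    DistContinuous w F ↔ Continuous fun θ => (F θ).prob := by
  constructor
  · intro h
    refine continuous_pi fun B => continuous_iff_continuousAt.2 fun θ => ?_
    rw [ContinuousAt, tendsto_iff_dist_tendsto_zero]
    have h' : Tendsto (fun θ' => (w B)⁻¹ * distDist w (F θ') (F θ)) (𝓝 θ) (𝓝 0) := by
      simpa using (h θ).const_mul (w B)⁻¹
    refine squeeze_zero (fun _ => dist_nonneg) (fun θ' => ?_) h'
    rw [Real.dist_eq, le_inv_mul_iff₀ (hw_pos B)]
    exact (summable_distDist hw_pos hw_sum (F θ') (F θ)).le_tsum B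
      fun C _ => mul_nonneg (hw_pos C).le (abs_nonneg _)
  · intro h θ
    have h0 : (0 : ℝ) = ∑' B : List A, 0 := by simp
    rw [h0]
    refine tendsto_tsum_of_dominated_convergence hw_sum (fun B => ?_)
      (Eventually.of_forall fun θ' B => ?_)
    · have hB : Tendsto (fun θ' => (F θ').prob B) (𝓝 θ) (𝓝 ((F θ).prob B)) :=
        ((continuous_apply B).comp h).tendsto θ
      have := ((hB.sub_const ((F θ).prob B)).abs).const_mul (w B)
      simpa using this
    · rw [Real.norm_eq_abs, abs_mul, abs_abs, abs_of_pos (hw_pos B)]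
      refine mul_le_of_le_one_right (hw_pos B).le ?_
      rw [abs_le]
      constructor <;> linarith [(F θ').prob_nonneg B, (F θ').prob_le_one B, (F θ).prob_nonneg B,
        (F θ).prob_le_one B]

lemma CompactlyParametrized.isCompact_image_prob (hw_pos : ∀ B, 0 < w B) (hw_sum : Summable w)
    {Θ : Type*} [TopologicalSpace Θ] {H : Set (StatProc A)} (h : CompactlyParametrized w Θ H) :
    IsCompact (StatProc.prob '' H) := by
  obtain ⟨hΘ, F, hF, rfl⟩ := h
  rw [← Set.range_comp]
  exact isCompact_range ((distContinuous_iff hw_pos hw_sum).1 hF)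

/-- A continuous map into the stationary processes pulls back sets that are closed for the
distributional distance to closed sets. -/
lemma DistClosed.isClosed_preimage {H : Set (StatProc A)} (hH : DistClosed w H) {Θ : Type*}
    [TopologicalSpace Θ] {F : Θ → StatProc A} (hF : DistContinuous w F) :
    IsClosed (F ⁻¹' H) := by
  refine isClosed_of_closure_subset fun θ hθ => hH _ fun ε hε => ?_
  obtain ⟨θ', h1, h2⟩ := mem_closure_iff_nhds.1 hθ _ ((hF θ).eventually (gt_mem_nhds hε))
  refine ⟨F θ', h2, ?_⟩
  have h1' : distDist w (F θ') (F θ) < ε := h1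
  simpa only [distDist, abs_sub_comm] using h1'

end Distance

/-! ### Compactness of the space of stationary processes -/

section Compactness

variable {A : Type*} [Finite A] [MeasurableSpace A] [DiscreteMeasurableSpace A]

lemma continuous_measureReal_wordSet [TopologicalSpace A] [DiscreteTopology A] (B : List A) :
    Continuous fun ρ : ProbabilityMeasure (ℕ → A) => (ρ : Measure (ℕ → A)).real (wordSet B) := by
  have hclopen : IsClopen (wordSet B) := by
    have : wordSet B = ⋂ i : Fin B.length, (fun x : ℕ → A => x i) ⁻¹' {B[i]} := by
      ext x
      simp [mem_wordSet, Fin.forall_iff]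
    rw [this]
    exact isClopen_iInter_of_finite fun i => (isClopen_discrete _).preimage (continuous_apply _)
  refine continuous_iff_continuousAt.2 fun ρ => ?_
  have h := ProbabilityMeasure.tendsto_measure_of_null_frontier_of_tendsto
    (μ := ρ) (μs := id) (L := 𝓝 ρ) tendsto_id (E := wordSet B)
    (by rw [hclopen.frontier_eq]; simp)
  exact (NNReal.continuous_coe.tendsto _).comp h

/-- The set of word probabilities of stationary processes is compact. -/
lemma isCompact_range_prob : IsCompact (Set.range (StatProc.prob : StatProc A → List A → ℝ)) := by
  let _ : TopologicalSpace A := ⊥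
  have : DiscreteTopology A := ⟨rfl⟩
  have := Fintype.ofFinite A
  have hcl : IsClosed {ρ : ProbabilityMeasure (ℕ → A) | IsStationary ρ} := by
    have : {ρ : ProbabilityMeasure (ℕ → A) | IsStationary ρ} = ⋂ B : List A,
        {ρ : ProbabilityMeasure (ℕ → A) | ∑ a, (ρ : Measure (ℕ → A)).real (wordSet (a :: B)) =
          (ρ : Measure (ℕ → A)).real (wordSet B)} := by
      ext ρ
      simp only [Set.mem_ofPred_eq, Set.mem_iInter]
      constructor
      · intro h B
        exact StatProc.sum_prob_cons ⟨ρ, h⟩ B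
      · intro h
        rw [isStationary_iff_map_shift]
        have : IsFiniteMeasure ((ρ : Measure (ℕ → A)).map shift) := inferInstance
        refine measure_ext_of_wordSet 0 fun B _ => ?_
        rw [Measure.map_apply measurable_shift (measurableSet_wordSet B),
          measure_preimage_shift_eq_sum, ← ofReal_measureReal (s := wordSet B), ← h B,
          ENNReal.ofReal_sum_of_nonneg fun _ _ => measureReal_nonneg]
        exact Finset.sum_congr rfl fun a _ => (ofReal_measureReal).symm
    rw [this]
    exact isClosed_iInter fun B => isClosed_eq
      (continuous_finsetSum _ fun a _ => continuous_measureReal_wordSet _)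
      (continuous_measureReal_wordSet _)
  have himage : Set.range (StatProc.prob : StatProc A → List A → ℝ) =
      (fun (ρ : ProbabilityMeasure (ℕ → A)) B => (ρ : Measure (ℕ → A)).real (wordSet B)) ''
        {ρ | IsStationary ρ} := by
    ext v
    constructor
    · rintro ⟨ρ, rfl⟩
      exact ⟨ρ.1, ρ.2, rfl⟩
    · rintro ⟨ρ, hρ, rfl⟩
      exact ⟨⟨ρ, hρ⟩, rfl⟩
  rw [himage]
  exact hcl.isCompact.image (continuous_pi continuous_measureReal_wordSet)

/-- A closed relation that determines a stationary process for each parameter defines a continuous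
family. -/
lemma continuous_prob_of_isClosed {Θ : Type*} [TopologicalSpace Θ] {F : Θ → StatProc A}
    {R : Set (Θ × (List A → ℝ))} (hR : IsClosed R) (hF : ∀ θ, (θ, (F θ).prob) ∈ R)
    (huniq : ∀ θ ρ, (θ, StatProc.prob ρ) ∈ R → ρ = F θ) :
    Continuous fun θ => (F θ).prob := by
  have : CompactSpace (Set.range (StatProc.prob : StatProc A → List A → ℝ)) :=
    isCompact_iff_compactSpace.1 isCompact_range_prob
  refine continuous_iff_isClosed.2 fun C hC => ?_
  have hi : Continuous fun z : Θ × Set.range (StatProc.prob : StatProc A → List A → ℝ) =>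
      (z.1, z.2.1) := by fun_prop
  have : (fun θ => (F θ).prob) ⁻¹' C =
      Prod.fst '' {z : Θ × Set.range (StatProc.prob : StatProc A → List A → ℝ) |
        (z.1, z.2.1) ∈ R ∧ z.2.1 ∈ C} := by
    ext θ
    constructor
    · intro h
      exact ⟨(θ, ⟨(F θ).prob, F θ, rfl⟩), ⟨hF θ, h⟩, rfl⟩
    · rintro ⟨⟨θ, _, ρ, rfl⟩, ⟨h1, h2⟩, rfl⟩
      rw [huniq _ _ h1] at h2
      exact h2
  rw [this]
  exact isClosedMap_fst_of_compactSpace _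
    ((hR.preimage hi).inter (hC.preimage (continuous_subtype_val.comp continuous_snd)))

end Compactness

/-! ### Existence and uniqueness of Markov sources -/

section Markov

variable {A : Type*} {k : ℕ}

lemma exists_eq_ofFn {L : List A} (h : L.length = k) : ∃ s : Fin k → A, L = List.ofFn s := by
  subst h
  exact ⟨L.get, (List.ofFn_get L).symm⟩

lemma exists_eq_append_ofFn_concat {B : List A} (h : k < B.length) :
    ∃ (u : List A) (s : Fin k → A) (a : A), B = u ++ List.ofFn s ++ [a] := by
  have hne : B ≠ [] := by rintro rfl; simp at h
  obtain ⟨s, hs⟩ := exists_eq_ofFn (k := k) (L := B.dropLast.drop (B.length - 1 - k))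
    (by simp; omega)
  refine ⟨B.dropLast.take (B.length - 1 - k), s, B.getLast hne, ?_⟩
  rw [← hs, List.take_append_drop, List.dropLast_append_getLast]

variable [Fintype A]

lemma sum_cons {M : Type*} [AddCommMonoid M] {n : ℕ} (f : (Fin (n + 1) → A) → M) :
    ∑ b, f b = ∑ b : Fin n → A, ∑ a, f (Fin.cons a b) := by
  rw [← (Fin.consEquiv fun _ : Fin (n + 1) => A).sum_comp, Fintype.sum_prod_type_right]
  rfl

lemma sum_ite_tail_snoc [DecidableEq A] (f : (Fin (k + 1) → A) → ℝ) (v : Fin k → A) :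
    (∑ s : Fin k → A, ∑ a : A, if Fin.tail (Fin.snoc s a : Fin (k + 1) → A) = v
      then f (Fin.snoc s a) else 0) = ∑ a, f (Fin.cons a v) := by
  rw [← sum_snoc (fun w => if Fin.tail w = v then f w else 0), sum_cons, Finset.sum_comm]
  exact Finset.sum_congr rfl fun a _ => by simp

variable [MeasurableSpace A] [DiscreteMeasurableSpace A]

/-- A stationary source is determined by its transition probabilities of order `k` and its
probabilities of words of length `k`. -/
lemma HasTransitions.eq_of_prob_eq {p : Transitions k A} {ρ ρ' : StatProc A}
    (h : HasTransitions p ρ) (h' : HasTransitions p ρ')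
    (hs : ∀ s : Fin k → A, ρ.prob (List.ofFn s) = ρ'.prob (List.ofFn s)) : ρ = ρ' := by
  have key : ∀ (m : ℕ) (B : List A), B.length = k + m → ρ.prob B = ρ'.prob B := by
    intro m
    induction m with
    | zero =>
      intro B hB
      obtain ⟨s, rfl⟩ := exists_eq_ofFn hB
      exact hs s
    | succ m ih =>
      intro B hB
      obtain ⟨u, s, a, rfl⟩ := exists_eq_append_ofFn_concat (k := k) (B := B) (by omega)
      rw [h, h', ih]
      simp only [List.length_append, List.length_ofFn, List.length_singleton] at hB ⊢
      omega
  exact StatProc.ext_of_prob k fun B hB => key (B.length - k) B (by omega)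

/-- `IsMarkovUpTo π p m μ`: the first `k` letters have law `π` under `μ`, and the next `m` letters
are drawn according to the transition probabilities `p`. -/
def IsMarkovUpTo (π : (Fin k → A) → ℝ) (p : Transitions k A) (m : ℕ) (μ : Measure (ℕ → A)) :
    Prop :=
  (∀ s : Fin k → A, μ.real (wordSet (List.ofFn s)) = π s) ∧
    ∀ (u : List A) (s : Fin k → A) (a : A), u.length < m →
      μ.real (wordSet (u ++ List.ofFn s ++ [a])) =
        μ.real (wordSet (u ++ List.ofFn s)) * (p s : A → ℝ) a

lemma exists_isMarkovUpTo_zero [Nonempty A] (π : stdSimplex ℝ (Fin k → A))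
    (p : Transitions k A) :
    ∃ μ : ProbabilityMeasure (ℕ → A), IsMarkovUpTo π p 0 (μ : Measure (ℕ → A)) := by
  classical
  let e : (Fin k → A) → ℕ → A := fun s i =>
    if h : i < k then s ⟨i, h⟩ else Classical.arbitrary A
  let μ : Measure (ℕ → A) :=
    ∑ s, ENNReal.ofReal ((π : (Fin k → A) → ℝ) s) • Measure.dirac (e s)
  have hμ : IsProbabilityMeasure μ := ⟨by
    simp only [μ, Measure.finsetSum_apply, Measure.smul_apply, measure_univ, smul_eq_mul, mul_one]
    rw [← ENNReal.ofReal_sum_of_nonneg fun s _ => stdSimplex.zero_le π s,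
      stdSimplex.sum_eq_one π, ENNReal.ofReal_one]⟩
  refine ⟨⟨μ, hμ⟩, fun s => ?_, by simp⟩
  have hmem : ∀ t, e t ∈ wordSet (List.ofFn s) ↔ t = s := by
    intro t
    rw [mem_wordSet]
    constructor
    · intro h
      funext i
      have := h i (by simp)
      simpa [e] using this
    · rintro rfl i hi
      have hi' : i < k := by simpa using hi
      simp [e, hi']
  change μ.real _ = _
  have hv : μ (wordSet (List.ofFn s)) = ENNReal.ofReal ((π : (Fin k → A) → ℝ) s) := by
    simp only [μ, Measure.finsetSum_apply, Measure.smul_apply, smul_eq_mul,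
      Measure.dirac_apply' _ (measurableSet_wordSet _), Set.indicator_apply, hmem]
    simp
  rw [Measure.real, hv, ENNReal.toReal_ofReal (stdSimplex.zero_le π s)]

/-- One more letter is drawn by resampling the letter with index `m + k`. -/
lemma IsMarkovUpTo.exists_succ {π : (Fin k → A) → ℝ} {p : Transitions k A} {m : ℕ}
    {μ : ProbabilityMeasure (ℕ → A)} (h : IsMarkovUpTo π p m (μ : Measure (ℕ → A))) :
    ∃ ν : ProbabilityMeasure (ℕ → A), IsMarkovUpTo π p (m + 1) (ν : Measure (ℕ → A)) := by
  classical
  let b : (ℕ → A) → Fin k → A := fun x j => x (m + j)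
  let c : A → (ℕ → A) → ENNReal := fun a x => ENNReal.ofReal ((p (b x) : A → ℝ) a)
  have hbm : Measurable b := measurable_pi_iff.2 fun j => measurable_pi_apply _
  have hcm : ∀ a, Measurable (c a) := fun a =>
    (measurable_of_finite fun s : Fin k → A => ENNReal.ofReal ((p s : A → ℝ) a)).comp hbm
  have hc1 : ∀ x, ∑ a, c a x = 1 := fun x => by
    simp only [c]
    rw [← ENNReal.ofReal_sum_of_nonneg fun a _ => stdSimplex.zero_le (p (b x)) a,
      stdSimplex.sum_eq_one (p (b x)),
      ENNReal.ofReal_one]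
  let U : A → (ℕ → A) → ℕ → A := fun a x => Function.update x (m + k) a
  have hUm : ∀ a, Measurable (U a) := fun a => measurable_pi_iff.2 fun i => by
    by_cases hi : i = m + k
    · subst hi; simp [U]
    · simpa [U, hi] using measurable_pi_apply i
  let ν : Measure (ℕ → A) := ∑ a, ((μ : Measure (ℕ → A)).withDensity (c a)).map (U a)
  have hν : ∀ E, MeasurableSet E → ν E =
      ∑ a, ∫⁻ x in U a ⁻¹' E, c a x ∂(μ : Measure (ℕ → A)) := fun E hE => by
    simp only [ν, Measure.finsetSum_apply]
    exact Finset.sum_congr rfl fun a _ => by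
      rw [Measure.map_apply (hUm a) hE, withDensity_apply _ (hUm a hE)]
  have hν1 : IsProbabilityMeasure ν := ⟨by
    rw [hν _ MeasurableSet.univ]
    simp only [Set.preimage_univ, Measure.restrict_univ]
    rw [← lintegral_finsetSum _ fun a _ => hcm a]
    simp [hc1]⟩
  -- Cylinders of words that end before the new letter keep their measure.
  have hold : ∀ B : List A, B.length ≤ m + k →
      ν.real (wordSet B) = (μ : Measure (ℕ → A)).real (wordSet B) := by
    intro B hB
    have hpre : ∀ a, U a ⁻¹' wordSet B = wordSet B := by
      intro a
      ext x
      simp only [Set.mem_preimage, mem_wordSet, U]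
      refine forall₂_congr fun i hi => ?_
      rw [Function.update_of_ne (by omega)]
    rw [Measure.real, Measure.real, hν _ (measurableSet_wordSet B)]
    simp only [hpre]
    rw [← lintegral_finsetSum _ fun a _ => hcm a]
    simp [hc1]
  have hnew : ∀ (u : List A) (s : Fin k → A) (a : A), u.length = m →
      ν.real (wordSet (u ++ List.ofFn s ++ [a])) =
        (μ : Measure (ℕ → A)).real (wordSet (u ++ List.ofFn s)) * (p s : A → ℝ) a := by
    intro u s a hu
    have hlen : (u ++ List.ofFn s).length = m + k := by simp [hu]
    have hpre : ∀ a', U a' ⁻¹' wordSet (u ++ List.ofFn s ++ [a]) =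
        if a' = a then wordSet (u ++ List.ofFn s) else ∅ := by
      intro a'
      ext x
      have h1 : U a' x ∈ wordSet (u ++ List.ofFn s) ↔ x ∈ wordSet (u ++ List.ofFn s) := by
        simp only [mem_wordSet, U]
        refine forall₂_congr fun i hi => ?_
        rw [Function.update_of_ne (by omega)]
      have h2 : U a' x (m + k) = a' := by simp [U]
      rw [Set.mem_preimage, mem_wordSet_concat, h1, hlen, h2]
      split_ifs with haa <;> simp [haa]
    have hconst : ∀ x ∈ wordSet (u ++ List.ofFn s), c a x = ENNReal.ofReal ((p s : A → ℝ) a) := by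
      intro x hx
      have : b x = s := by
        funext j
        have h1 := mem_wordSet.1 hx (m + j) (by rw [hlen]; omega)
        simpa [b, List.getElem_append_right, hu] using h1
      simp only [c, this]
    have hval : ν (wordSet (u ++ List.ofFn s ++ [a])) =
        (μ : Measure (ℕ → A)) (wordSet (u ++ List.ofFn s)) * ENNReal.ofReal ((p s : A → ℝ) a) := by
      rw [hν _ (measurableSet_wordSet _), Finset.sum_eq_single a]
      · rw [hpre, if_pos rfl, setLIntegral_congr_fun (measurableSet_wordSet _) hconst,
          setLIntegral_const, mul_comm]
      · intro a' _ ha'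
        rw [hpre, if_neg ha']
        simp
      · simp
    rw [Measure.real, hval, ENNReal.toReal_mul, ENNReal.toReal_ofReal (stdSimplex.zero_le (p s) a)]
    rfl
  refine ⟨⟨ν, hν1⟩, fun s => ?_, fun u s a hu => ?_⟩
  · change ν.real _ = _
    rw [hold _ (by simp), h.1]
  · change ν.real _ = ν.real _ * _
    rw [hold (u ++ List.ofFn s) (by simp; omega)]
    rcases (Nat.lt_succ_iff.1 hu).lt_or_eq with h1 | h1
    · rw [hold _ (by simp; omega), h.2 u s a h1]
    · exact hnew u s a h1

/-- A measure that follows the transition probabilities `p` at all times, with an initial law that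
is invariant under `p`, is stationary. -/
lemma isStationary_of_forall_isMarkovUpTo [DecidableEq A] {π : (Fin k → A) → ℝ}
    {p : Transitions k A}
    (hinv : ∀ v : Fin k → A, (∑ s : Fin k → A, ∑ a : A,
      if Fin.tail (Fin.snoc s a : Fin (k + 1) → A) = v then π s * (p s : A → ℝ) a else 0) = π v)
    {μ : ProbabilityMeasure (ℕ → A)} (h : ∀ m, IsMarkovUpTo π p m (μ : Measure (ℕ → A))) :
    IsStationary μ := by
  have htr : ∀ (u : List A) (s : Fin k → A) (a : A),
      (μ : Measure (ℕ → A)).real (wordSet (u ++ List.ofFn s ++ [a])) =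
        (μ : Measure (ℕ → A)).real (wordSet (u ++ List.ofFn s)) * (p s : A → ℝ) a :=
    fun u s a => (h (u.length + 1)).2 u s a (Nat.lt_succ_self _)
  have key : ∀ (m : ℕ) (B : List A), B.length = k + m →
      ∑ a, (μ : Measure (ℕ → A)).real (wordSet (a :: B)) =
        (μ : Measure (ℕ → A)).real (wordSet B) := by
    intro m
    induction m with
    | zero =>
      intro B hB
      obtain ⟨v, rfl⟩ := exists_eq_ofFn hB
      rw [(h 0).1, ← hinv v]
      have := sum_ite_tail_snoc
        (fun w => (μ : Measure (ℕ → A)).real (wordSet (List.ofFn w))) v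
      simp only [List.ofFn_cons, ofFn_snoc] at this
      rw [← this]
      refine Finset.sum_congr rfl fun s _ => Finset.sum_congr rfl fun a _ => ?_
      have h1 := htr [] s a
      simp only [List.nil_append, (h 0).1] at h1
      rw [h1]
    | succ m ih =>
      intro B hB
      obtain ⟨u, s, a, rfl⟩ := exists_eq_append_ofFn_concat (k := k) (B := B) (by omega)
      have hl : (u ++ List.ofFn s).length = k + m := by
        simp only [List.length_append, List.length_ofFn, List.length_singleton] at hB ⊢
        omega
      rw [htr, ← ih _ hl, Finset.sum_mul]
      exact Finset.sum_congr rfl fun a' _ => htr (a' :: u) s a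
  rw [isStationary_iff_map_shift]
  have : IsFiniteMeasure ((μ : Measure (ℕ → A)).map shift) := inferInstance
  refine measure_ext_of_wordSet k fun B hB => ?_
  rw [Measure.map_apply measurable_shift (measurableSet_wordSet B),
    measure_preimage_shift_eq_sum, ← ofReal_measureReal (s := wordSet B),
    ← key (B.length - k) B (by omega), ENNReal.ofReal_sum_of_nonneg fun _ _ => measureReal_nonneg]
  exact Finset.sum_congr rfl fun a _ => (ofReal_measureReal).symm

/-- Transition probabilities together with an invariant initial law belong to a stationary
source. -/
lemma exists_hasTransitions [DecidableEq A] (θ : MarkovParam k A) :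
    ∃ ρ : StatProc A, HasTransitions θ.1.2 ρ ∧
      ∀ s : Fin k → A, ρ.prob (List.ofFn s) = (θ.1.1 : (Fin k → A) → ℝ) s := by
  obtain ⟨⟨π, p⟩, hinv⟩ := θ
  have hA : Nonempty A := by
    by_contra hA
    have : IsEmpty A := not_nonempty_iff.1 hA
    have h1 : Nonempty (Fin k → A) := by
      by_contra h2
      have : IsEmpty (Fin k → A) := not_nonempty_iff.1 h2
      simpa using π.2.2
    simpa using (p h1.some).2.2
  let _ : TopologicalSpace A := ⊥
  have : DiscreteTopology A := ⟨rfl⟩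
  let C : ℕ → Set (ProbabilityMeasure (ℕ → A)) := fun m =>
    {μ | IsMarkovUpTo π p m (μ : Measure (ℕ → A))}
  have hC : ∀ m, IsClosed (C m) := by
    intro m
    have : C m = (⋂ s : Fin k → A,
        {μ : ProbabilityMeasure (ℕ → A) | (μ : Measure (ℕ → A)).real (wordSet (List.ofFn s)) =
        (π : (Fin k → A) → ℝ) s}) ∩ ⋂ (u : List A) (s : Fin k → A) (a : A) (_ : u.length < m),
        {μ : ProbabilityMeasure (ℕ → A) |
          (μ : Measure (ℕ → A)).real (wordSet (u ++ List.ofFn s ++ [a])) =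
          (μ : Measure (ℕ → A)).real (wordSet (u ++ List.ofFn s)) * (p s : A → ℝ) a} := by
      ext μ
      simp [C, IsMarkovUpTo]
    rw [this]
    refine (isClosed_iInter fun s => isClosed_eq (continuous_measureReal_wordSet _)
      continuous_const).inter ?_
    exact isClosed_iInter fun u => isClosed_iInter fun s => isClosed_iInter fun a =>
      isClosed_iInter fun _ => isClosed_eq (continuous_measureReal_wordSet _)
        ((continuous_measureReal_wordSet _).mul continuous_const)
  have hne : ∀ m, (C m).Nonempty := by
    intro m
    induction m with
    | zero => exact exists_isMarkovUpTo_zero π p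
    | succ m ih =>
      obtain ⟨μ, hμ⟩ := ih
      exact IsMarkovUpTo.exists_succ hμ
  obtain ⟨μ, hμ⟩ := IsCompact.nonempty_iInter_of_sequence_nonempty_isCompact_isClosed C
    (fun m μ hμ => ⟨hμ.1, fun u s a hu => hμ.2 u s a (hu.trans (Nat.lt_succ_self m))⟩) hne
    (hC 0).isCompact hC
  have hμ' : ∀ m, IsMarkovUpTo π p m (μ : Measure (ℕ → A)) := Set.mem_iInter.1 hμ
  refine ⟨⟨μ, isStationary_of_forall_isMarkovUpTo hinv hμ'⟩, fun u s a => ?_, (hμ' 0).1⟩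
  exact (hμ' (u.length + 1)).2 u s a (Nat.lt_succ_self _)

/-- The parameters of a Markov source: its law on words of length `k`, which is invariant. -/
lemma HasTransitions.exists_markovParam [DecidableEq A] {p : Transitions k A} {ρ : StatProc A}
    (h : HasTransitions p ρ) : ∃ θ : MarkovParam k A, θ.1.2 = p ∧
      ∀ s : Fin k → A, (θ.1.1 : (Fin k → A) → ℝ) s = ρ.prob (List.ofFn s) := by
  have hsum : ∀ n, ∑ b : Fin n → A, ρ.prob (List.ofFn b) = 1 := by
    intro n
    induction n with
    | zero => simp [StatProc.prob_eq]
    | succ n ih =>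
      rw [sum_snoc, ← ih]
      refine Finset.sum_congr rfl fun b _ => ?_
      simp only [ofFn_snoc]
      exact ρ.sum_prob_concat _
  refine ⟨⟨(⟨fun s => ρ.prob (List.ofFn s), fun s => ρ.prob_nonneg _, hsum k⟩, p), fun v => ?_⟩,
    rfl, fun s => rfl⟩
  have h1 := sum_ite_tail_snoc (fun w => ρ.prob (List.ofFn w)) v
  simp only [List.ofFn_cons, ofFn_snoc, ρ.sum_prob_cons] at h1
  refine Eq.trans (Finset.sum_congr rfl fun s _ => Finset.sum_congr rfl fun a _ => ?_) h1
  have h2 := h [] s a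
  simp only [List.nil_append] at h2
  rw [h2]
  rfl

end Markov

/-! ### Components of Markov sources -/

section Components

variable {A : Type*}

lemma mem_wordSet_append_iff {x : ℕ → A} {B C : List A} :
    x ∈ wordSet (B ++ C) ↔ window x 0 B.length = B ∧ shift^[B.length] x ∈ wordSet C := by
  rw [mem_wordSet_append, wordSet, wordSet, Set.mem_ofPred_eq, Set.mem_ofPred_eq,
    window_iterate_shift, add_zero]

lemma mem_wordSet_iff_take {x : ℕ → A} {L C : List A} (hx : x ∈ wordSet L)
    (h : C.length ≤ L.length) : x ∈ wordSet C ↔ L.take C.length = C := by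
  have hL : window x 0 L.length = L := hx
  conv_rhs => rw [← hL, take_window x h]
  rfl

/-- The fluctuation of the occurrences of `B ++ [a]` around the share `c` of the occurrences
of `B`. -/
noncomputable def fluctuation (B : List A) (a : A) (c : ℝ) (x : ℕ → A) : ℝ :=
  (wordSet (B ++ [a])).indicator 1 x - c * (wordSet B).indicator 1 x

lemma abs_fluctuation_le (B : List A) (a : A) {c : ℝ} (h0 : 0 ≤ c) (h1 : c ≤ 1) (x : ℕ → A) :
    |fluctuation B a c x| ≤ 1 := by
  have hc : |c| ≤ 1 := abs_le.2 ⟨by linarith, h1⟩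
  by_cases hB : x ∈ wordSet B
  · by_cases ha : x ∈ wordSet (B ++ [a])
    · simp only [fluctuation, Set.indicator_of_mem hB, Set.indicator_of_mem ha, Pi.one_apply]
      rw [abs_le]
      constructor <;> linarith
    · simpa [fluctuation, hB, ha] using hc
  · have ha : x ∉ wordSet (B ++ [a]) := fun h => hB (mem_wordSet_concat.1 h).1
    simp [fluctuation, hB, ha]

variable [MeasurableSpace A] [DiscreteMeasurableSpace A]

section Finite

variable [Finite A]

lemma measurable_fluctuation (B : List A) (a : A) (c : ℝ) : Measurable (fluctuation B a c) :=
  (measurable_one.indicator (measurableSet_wordSet _)).sub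
    ((measurable_one.indicator (measurableSet_wordSet _)).const_mul c)

lemma integral_fluctuation (ρ : StatProc A) (B : List A) (a : A) (c : ℝ) :
    ∫ x, fluctuation B a c x ∂ρ.law = ρ.prob (B ++ [a]) - c * ρ.prob B := by
  have hi : ∀ C : List A, Integrable ((wordSet C).indicator (1 : (ℕ → A) → ℝ)) ρ.law := fun C =>
    (integrable_const (1 : ℝ)).indicator (measurableSet_wordSet C)
  simp only [fluctuation]
  rw [integral_sub (hi _) ((hi _).const_mul c), integral_const_mul,
    integral_indicator_one (measurableSet_wordSet _),
    integral_indicator_one (measurableSet_wordSet _)]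
  rfl

lemma integrable_fluctuation_mul (ρ : StatProc A) (B : List A) (a : A) {c : ℝ} (h0 : 0 ≤ c)
    (h1 : c ≤ 1) (i j : ℕ) : Integrable
      (fun x => fluctuation B a c (shift^[i] x) * fluctuation B a c (shift^[j] x)) ρ.law := by
  refine Integrable.of_bound (C := 1)
    (((measurable_fluctuation B a c).comp (measurable_shift.iterate i)).mul
      ((measurable_fluctuation B a c).comp (measurable_shift.iterate j))).aestronglyMeasurable
    (Eventually.of_forall fun x => ?_)
  rw [Real.norm_eq_abs, abs_mul]
  exact mul_le_one₀ (abs_fluctuation_le B a h0 h1 _) (abs_nonneg _)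
    (abs_fluctuation_le B a h0 h1 _)

end Finite

variable [Fintype A] {k : ℕ} {p : Transitions k A} {ρ : StatProc A}

/-- The fluctuations of a Markov source at different times are orthogonal: the later one has
conditional mean zero given the past, which determines the earlier one. -/
lemma HasTransitions.integral_fluctuation_mul_shift (h : HasTransitions p ρ) (u : List A)
    (s : Fin k → A) (a : A) {j : ℕ} (hj : 0 < j) :
    ∫ x, fluctuation (u ++ List.ofFn s) a ((p s : A → ℝ) a) x *
      fluctuation (u ++ List.ofFn s) a ((p s : A → ℝ) a) (shift^[j] x) ∂ρ.law = 0 := by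
  classical
  set B := u ++ List.ofFn s with hB
  set c : ℝ := (p s : A → ℝ) a with hc
  -- The value of the earlier fluctuation on the cylinder of a word `L` of length above `|B|`.
  let G : List A → ℝ := fun L => (if L.take (B ++ [a]).length = B ++ [a] then 1 else 0) -
    c * (if L.take B.length = B then 1 else 0)
  have hG : ∀ (L : List A) (x : ℕ → A), B.length < L.length → x ∈ wordSet L →
      fluctuation B a c x = G L := by
    intro L x hL hx
    have e1 := mem_wordSet_iff_take hx (C := B ++ [a]) (by simp; omega)
    have e2 := mem_wordSet_iff_take hx (C := B) hL.le
    simp only [fluctuation, Set.indicator_apply, e1, e2, G, Pi.one_apply]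
  have hpt : ∀ x, fluctuation B a c x * fluctuation B a c (shift^[j] x) =
      ∑ v : Fin j → A, G (List.ofFn v ++ B) * fluctuation (List.ofFn v ++ B) a c x := by
    intro x
    let v₀ : Fin j → A := fun i => x (0 + i)
    have hv₀ : window x 0 j = List.ofFn v₀ := rfl
    have hmem : ∀ (v : Fin j → A) (C : List A), x ∈ wordSet (List.ofFn v ++ C) ↔
        v = v₀ ∧ shift^[j] x ∈ wordSet C := by
      intro v C
      rw [mem_wordSet_append_iff, List.length_ofFn, hv₀, List.ofFn_inj, eq_comm]
    rw [Finset.sum_eq_single v₀]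
    · have hfl : fluctuation (List.ofFn v₀ ++ B) a c x = fluctuation B a c (shift^[j] x) := by
        simp only [fluctuation, Set.indicator_apply, List.append_assoc, hmem, true_and,
          Pi.one_apply]
      rw [hfl]
      by_cases hx : shift^[j] x ∈ wordSet B
      · rw [hG (List.ofFn v₀ ++ B) x (by simp; omega) ((hmem v₀ B).2 ⟨rfl, hx⟩)]
      · have hx' : shift^[j] x ∉ wordSet (B ++ [a]) := fun h => hx (mem_wordSet_concat.1 h).1
        simp [fluctuation, hx, hx']
    · intro v _ hv
      simp [fluctuation, List.append_assoc, hmem, hv]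
    · simp
  have hi : ∀ v : Fin j → A, Integrable
      (fun x => G (List.ofFn v ++ B) * fluctuation (List.ofFn v ++ B) a c x) ρ.law := fun v =>
    (Integrable.of_bound (C := 1) (measurable_fluctuation _ _ _).aestronglyMeasurable
      (Eventually.of_forall fun x => abs_fluctuation_le _ a (stdSimplex.zero_le (p s) a)
        (stdSimplex.le_one (p s) a) x)).const_mul _
  simp only [hpt]
  rw [integral_finsetSum _ fun v _ => hi v]
  refine Finset.sum_eq_zero fun v _ => ?_
  rw [integral_const_mul, integral_fluctuation]
  have h1 := h (List.ofFn v ++ u) s a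
  rw [List.append_assoc (List.ofFn v) u, ← hB, ← hc] at h1
  rw [h1]
  ring

/-- The Birkhoff sums of the fluctuations of a Markov source have at most linear variance. -/
lemma HasTransitions.integral_birkhoffSum_sq_le (h : HasTransitions p ρ) (u : List A)
    (s : Fin k → A) (a : A) (n : ℕ) :
    ∫ x, (birkhoffSum shift (fluctuation (u ++ List.ofFn s) a ((p s : A → ℝ) a)) n x) ^ 2 ∂ρ.law
      ≤ n := by
  set g := fluctuation (u ++ List.ofFn s) a ((p s : A → ℝ) a) with hg
  have h0 := stdSimplex.zero_le (p s) a
  have h1 := stdSimplex.le_one (p s) a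
  have hint := integrable_fluctuation_mul ρ (u ++ List.ofFn s) a h0 h1
  rw [← hg] at hint
  have horth : ∀ i j, i < j → ∫ x, g (shift^[i] x) * g (shift^[j] x) ∂ρ.law = 0 := by
    intro i j hij
    obtain ⟨d, rfl⟩ := Nat.exists_eq_add_of_lt hij
    have hmp := ρ.measurePreserving.iterate i
    have h2 := integral_map (μ := ρ.law) hmp.measurable.aemeasurable
      (f := fun x => g x * g (shift^[d + 1] x))
      (by rw [hmp.map_eq]; exact (hint 0 (d + 1)).aestronglyMeasurable)
    rw [hmp.map_eq, h.integral_fluctuation_mul_shift u s a (Nat.succ_pos d)] at h2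
    rw [h2]
    congr 1
    funext x
    rw [← Function.iterate_add_apply, add_comm (d + 1) i, ← add_assoc]
  have hexp : ∀ x, (birkhoffSum shift g n x) ^ 2 =
      ∑ i ∈ Finset.range n, ∑ j ∈ Finset.range n, g (shift^[i] x) * g (shift^[j] x) := fun x => by
    rw [sq, birkhoffSum, Finset.sum_mul_sum]
  simp only [hexp]
  rw [integral_finsetSum _ fun i _ => integrable_finsetSum _ fun j _ => hint i j]
  have hrow : ∀ i ∈ Finset.range n,
      ∫ x, ∑ j ∈ Finset.range n, g (shift^[i] x) * g (shift^[j] x) ∂ρ.law ≤ 1 := by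
    intro i hi
    rw [integral_finsetSum _ fun j _ => hint i j, Finset.sum_eq_single_of_mem i hi]
    · calc ∫ x, g (shift^[i] x) * g (shift^[i] x) ∂ρ.law ≤ ∫ x, (1 : ℝ) ∂ρ.law := by
            refine integral_mono (hint i i) (integrable_const _) fun x => ?_
            have := abs_fluctuation_le (u ++ List.ofFn s) a h0 h1 (shift^[i] x)
            rw [← hg] at this
            change g (shift^[i] x) * g (shift^[i] x) ≤ 1
            rw [← abs_mul_abs_self]
            exact mul_le_one₀ this (abs_nonneg _) this
        _ = 1 := by simp
    · intro j _ hji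
      rcases lt_or_gt_of_ne hji with hlt | hlt
      · rw [← horth j i hlt]
        congr 1
        funext x
        exact mul_comm _ _
      · exact horth i j hlt
  calc _ ≤ ∑ i ∈ Finset.range n, (1 : ℝ) := Finset.sum_le_sum hrow
    _ = n := by simp

/-- The mean fluctuation of any stationary process is controlled by its Birkhoff sums. -/
lemma sq_mul_integral_le_integral_birkhoffSum_sq (μ : StatProc A) (B : List A) (a : A) {c : ℝ}
    (h0 : 0 ≤ c) (h1 : c ≤ 1) (n : ℕ) :
    ENNReal.ofReal ((n * (μ.prob (B ++ [a]) - c * μ.prob B)) ^ 2) ≤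
      ∫⁻ x, ENNReal.ofReal ((birkhoffSum shift (fluctuation B a c) n x) ^ 2) ∂μ.law := by
  set g := fluctuation B a c with hg
  have hgm : Measurable g := measurable_fluctuation B a c
  have hgi : ∀ i, Integrable (fun x => g (shift^[i] x)) μ.law := fun i =>
    Integrable.of_bound (C := 1) (hgm.comp (measurable_shift.iterate i)).aestronglyMeasurable
      (Eventually.of_forall fun x => abs_fluctuation_le B a h0 h1 _)
  have hS : Integrable (birkhoffSum shift g n) μ.law := integrable_finsetSum _ fun i _ => hgi i
  have hS2 : Integrable (fun x => (birkhoffSum shift g n x) ^ 2) μ.law := by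
    have : (fun x => (birkhoffSum shift g n x) ^ 2) = fun x => ∑ i ∈ Finset.range n,
        ∑ j ∈ Finset.range n, g (shift^[i] x) * g (shift^[j] x) := by
      funext x
      rw [sq, birkhoffSum, Finset.sum_mul_sum]
    rw [this]
    exact integrable_finsetSum _ fun i _ => integrable_finsetSum _ fun j _ =>
      integrable_fluctuation_mul μ B a h0 h1 i j
  have hmean : ∫ x, birkhoffSum shift g n x ∂μ.law = n * (μ.prob (B ++ [a]) - c * μ.prob B) := by
    simp only [birkhoffSum]
    rw [integral_finsetSum _ fun i _ => hgi i, ← integral_fluctuation, ← hg]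
    have : ∀ i, ∫ x, g (shift^[i] x) ∂μ.law = ∫ x, g x ∂μ.law := fun i => by
      have hmp := μ.measurePreserving.iterate i
      have h2 := integral_map (μ := μ.law) hmp.measurable.aemeasurable
        (f := g) hgm.aestronglyMeasurable
      rw [hmp.map_eq] at h2
      exact h2.symm
    simp [this]
  rw [← ofReal_integral_eq_lintegral_ofReal hS2 (Eventually.of_forall fun x => sq_nonneg _),
    ← hmean]
  refine ENNReal.ofReal_le_ofReal ?_
  exact (even_two.convexOn_pow (𝕜 := ℝ)).map_integral_le (continuous_pow 2).continuousOn
    isClosed_univ (Eventually.of_forall fun x => Set.mem_univ _) hS hS2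

/-- Almost every component of a Markov source has the same transition probabilities. -/
theorem HasTransitions.ae_of_isErgodicDecomposition [DecidableEq A] (h : HasTransitions p ρ)
    {W : Measure (StatProc A)} (hW : IsErgodicDecomposition W ρ) :
    ∀ᵐ μ ∂W, HasTransitions p μ := by
  refine ae_all_iff.2 fun u => ae_all_iff.2 fun s => ae_all_iff.2 fun a => ?_
  set B := u ++ List.ofFn s with hB
  set c : ℝ := (p s : A → ℝ) a with hc
  have h0 : 0 ≤ c := stdSimplex.zero_le (p s) a
  have h1 : c ≤ 1 := stdSimplex.le_one (p s) a
  let e : StatProc A → ℝ := fun μ => μ.prob (B ++ [a]) - c * μ.prob B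
  have hem : Measurable e := (measurable_prob _).sub ((measurable_prob _).const_mul c)
  have hgm : ∀ n, Measurable fun x : ℕ → A =>
      ENNReal.ofReal ((birkhoffSum shift (fluctuation B a c) n x) ^ 2) := fun n => by
    unfold birkhoffSum
    exact ((Finset.measurable_fun_sum _ fun i _ =>
      (measurable_fluctuation B a c).comp (measurable_shift.iterate i)).pow_const 2).ennreal_ofReal
  have hle : ∀ n : ℕ, ENNReal.ofReal ((n : ℝ) ^ 2) * ∫⁻ μ, ENNReal.ofReal ((e μ) ^ 2) ∂W ≤
      ENNReal.ofReal n := by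
    intro n
    have h2 : ∫⁻ x, ENNReal.ofReal ((birkhoffSum shift (fluctuation B a c) n x) ^ 2) ∂ρ.law ≤
        ENNReal.ofReal n := by
      have hbd : ∀ x, |birkhoffSum shift (fluctuation B a c) n x| ≤ n := fun x => by
        refine (Finset.abs_sum_le_sum_abs _ _).trans ((Finset.sum_le_sum fun i _ =>
          abs_fluctuation_le B a h0 h1 (shift^[i] x)).trans_eq (by simp))
      have hint : Integrable
          (fun x => (birkhoffSum shift (fluctuation B a c) n x) ^ 2) ρ.law := by
        refine Integrable.of_bound (C := (n : ℝ) ^ 2) ?_ (Eventually.of_forall fun x => ?_)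
        · unfold birkhoffSum
          exact ((Finset.measurable_fun_sum _ fun i _ => (measurable_fluctuation B a c).comp
            (measurable_shift.iterate i)).pow_const 2).aestronglyMeasurable
        · rw [Real.norm_eq_abs, abs_pow]
          exact pow_le_pow_left₀ (abs_nonneg _) (hbd x) 2
      rw [← ofReal_integral_eq_lintegral_ofReal hint (Eventually.of_forall fun x => sq_nonneg _)]
      exact ENNReal.ofReal_le_ofReal (h.integral_birkhoffSum_sq_le u s a n)
    rw [lintegral_eq_of_isErgodicDecomposition hW (hgm n)] at h2
    rw [← lintegral_const_mul _ (hem.pow_const 2).ennreal_ofReal]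
    refine le_trans (lintegral_mono fun μ => ?_) h2
    rw [← ENNReal.ofReal_mul (sq_nonneg _), ← mul_pow]
    exact sq_mul_integral_le_integral_birkhoffSum_sq μ B a h0 h1 n
  have hzero : ∫⁻ μ, ENNReal.ofReal ((e μ) ^ 2) ∂W = 0 := by
    have hfin : ∫⁻ μ, ENNReal.ofReal ((e μ) ^ 2) ∂W ≠ ⊤ := by
      have := hle 1
      simp only [Nat.cast_one, one_pow, ENNReal.ofReal_one, one_mul] at this
      exact (this.trans_lt ENNReal.one_lt_top).ne
    by_contra hne
    have hpos : 0 < (∫⁻ μ, ENNReal.ofReal ((e μ) ^ 2) ∂W).toReal := ENNReal.toReal_pos hne hfin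
    obtain ⟨n, hn⟩ := exists_nat_gt (1 / (∫⁻ μ, ENNReal.ofReal ((e μ) ^ 2) ∂W).toReal)
    have hn0 : (0 : ℝ) < n := lt_trans (by positivity) hn
    have h3 := ENNReal.toReal_mono ENNReal.ofReal_ne_top (hle n)
    rw [ENNReal.toReal_mul, ENNReal.toReal_ofReal (sq_nonneg _),
      ENNReal.toReal_ofReal hn0.le] at h3
    rw [div_lt_iff₀ hpos] at hn
    nlinarith
  rw [lintegral_eq_zero_iff (hem.pow_const 2).ennreal_ofReal] at hzero
  filter_upwards [hzero] with μ hμ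
  have h4 : (e μ) ^ 2 ≤ 0 := ENNReal.ofReal_eq_zero.1 hμ
  have h5 : e μ = 0 := pow_eq_zero_iff two_ne_zero |>.1 (le_antisymm h4 (sq_nonneg _))
  have h6 : μ.prob (B ++ [a]) - c * μ.prob B = 0 := h5
  linarith

lemma closedUnderErgodicDecomposition_hasTransitions [DecidableEq A] (T : Set (Transitions k A)) :
    ClosedUnderErgodicDecomposition {ρ : StatProc A | ∃ p ∈ T, HasTransitions p ρ} := by
  rintro ρ ⟨p, hp, hρ⟩ W hW
  filter_upwards [hρ.ae_of_isErgodicDecomposition hW] with μ hμ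
  exact ⟨p, hp, hμ⟩

end Components

/-! ### Continuous parametrizations of Markov sources -/

section Parametrization

variable {A : Type*} [Fintype A] {k : ℕ}

/-- `v` satisfies the defining identities of the transition probabilities `p`. -/
def WordTransitions (p : Transitions k A) (v : List A → ℝ) : Prop :=
  ∀ (u : List A) (s : Fin k → A) (a : A),
    v (u ++ List.ofFn s ++ [a]) = v (u ++ List.ofFn s) * (p s : A → ℝ) a

lemma isClosed_wordTransitions :
    IsClosed {z : Transitions k A × (List A → ℝ) | WordTransitions z.1 z.2} := by
  simp only [WordTransitions, Set.ofPred_forall]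
  refine isClosed_iInter fun u => isClosed_iInter fun s => isClosed_iInter fun a => ?_
  have h1 : ∀ B : List A, Continuous fun z : Transitions k A × (List A → ℝ) => z.2 B :=
    fun B => (continuous_apply B).comp continuous_snd
  have h2 : Continuous fun z : Transitions k A × (List A → ℝ) => (z.1 s : A → ℝ) a :=
    (continuous_apply a).comp (continuous_subtype_val.comp
      ((continuous_apply s).comp continuous_fst))
  exact isClosed_eq (h1 _) ((h1 _).mul h2)

instance compactSpace_markovParam [DecidableEq A] : CompactSpace (MarkovParam k A) := by
  have hc : IsClosed {θ : stdSimplex ℝ (Fin k → A) × Transitions k A |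
      ∀ v : Fin k → A, (∑ s : Fin k → A, ∑ a : A,
        if Fin.tail (Fin.snoc s a : Fin (k + 1) → A) = v then
          (θ.1 : (Fin k → A) → ℝ) s * (θ.2 s : A → ℝ) a else 0) =
        (θ.1 : (Fin k → A) → ℝ) v} := by
    have h1 : ∀ s, Continuous fun θ : stdSimplex ℝ (Fin k → A) × Transitions k A =>
        (θ.1 : (Fin k → A) → ℝ) s := fun s =>
      (continuous_apply s).comp (continuous_subtype_val.comp continuous_fst)
    have h2 : ∀ s a, Continuous fun θ : stdSimplex ℝ (Fin k → A) × Transitions k A =>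
        (θ.2 s : A → ℝ) a := fun s a =>
      (continuous_apply a).comp (continuous_subtype_val.comp
        ((continuous_apply s).comp continuous_snd))
    simp only [Set.ofPred_forall]
    refine isClosed_iInter fun v => isClosed_eq (continuous_finsetSum _ fun s _ =>
      continuous_finsetSum _ fun a _ => ?_) (h1 v)
    split_ifs
    · exact (h1 s).mul (h2 s a)
    · exact continuous_const
  exact hc.isClosedEmbedding_subtypeVal.compactSpace

variable [MeasurableSpace A] [DiscreteMeasurableSpace A]

/-- If each member of a family of transition probabilities has exactly one source, then the source
depends continuously on the transition probabilities. -/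
lemma exists_continuous_source {w : List A → ℝ} (hw_pos : ∀ B, 0 < w B) (hw_sum : Summable w)
    {T : Set (Transitions k A)} (hT : ∀ p ∈ T, ∃! ρ : StatProc A, HasTransitions p ρ) :
    ∃ F : T → StatProc A, DistContinuous w F ∧ ∀ p : T, HasTransitions p.1 (F p) := by
  choose F hF huniq using fun p : T => hT p.1 p.2
  refine ⟨F, ?_, hF⟩
  rw [distContinuous_iff hw_pos hw_sum]
  refine continuous_prob_of_isClosed
    (R := {z : T × (List A → ℝ) | WordTransitions z.1.1 z.2}) ?_ hF huniq
  exact isClosed_wordTransitions.preimage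
    (f := fun z : T × (List A → ℝ) => (z.1.1, z.2)) (by fun_prop)

variable [DecidableEq A] {w : List A → ℝ}

/-- The continuous parametrization of the Markov sources of order `k`. -/
lemma exists_markovParam_map (hw_pos : ∀ B, 0 < w B) (hw_sum : Summable w) (k : ℕ) :
    ∃ F : MarkovParam k A → StatProc A, DistContinuous w F ∧
      Set.range F = markovSources k A ∧ ∀ θ : MarkovParam k A, HasTransitions θ.1.2 (F θ) ∧
        ∀ s : Fin k → A, (F θ).prob (List.ofFn s) = (θ.1.1 : (Fin k → A) → ℝ) s := by
  choose F hF hFs using fun θ : MarkovParam k A => exists_hasTransitions θ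
  have huniq : ∀ (θ : MarkovParam k A) (ρ : StatProc A), HasTransitions θ.1.2 ρ →
      (∀ s : Fin k → A, ρ.prob (List.ofFn s) = (θ.1.1 : (Fin k → A) → ℝ) s) → ρ = F θ :=
    fun θ ρ h hs => h.eq_of_prob_eq (hF θ) fun s => (hs s).trans (hFs θ s).symm
  refine ⟨F, ?_, ?_, fun θ => ⟨hF θ, hFs θ⟩⟩
  · rw [distContinuous_iff hw_pos hw_sum]
    refine continuous_prob_of_isClosed (R := {z : MarkovParam k A × (List A → ℝ) |
      WordTransitions z.1.1.2 z.2} ∩ ⋂ s : Fin k → A,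
        {z | z.2 (List.ofFn s) = (z.1.1.1 : (Fin k → A) → ℝ) s}) ?_ ?_ ?_
    · refine IsClosed.inter ?_ (isClosed_iInter fun s => isClosed_eq ?_ ?_)
      · exact isClosed_wordTransitions.preimage (f := fun z : MarkovParam k A × (List A → ℝ) =>
          (z.1.1.2, z.2)) (by fun_prop)
      · exact (continuous_apply _).comp continuous_snd
      · exact (continuous_apply s).comp (continuous_subtype_val.comp
          (continuous_fst.comp (continuous_subtype_val.comp continuous_fst)))
    · exact fun θ => ⟨hF θ, Set.mem_iInter.2 fun s => hFs θ s⟩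
    · exact fun θ ρ h => huniq θ ρ h.1 fun s => Set.mem_iInter.1 h.2 s
  · ext ρ
    constructor
    · rintro ⟨θ, rfl⟩
      exact ⟨θ.1.2, hF θ⟩
    · rintro ⟨p, hp⟩
      obtain ⟨θ, rfl, hθ⟩ := hp.exists_markovParam
      exact ⟨θ, (huniq θ ρ hp fun s => (hθ s).symm).symm⟩

/-- A closed set of Markov sources is parametrized by a compact set of Markov parameters. -/
lemma exists_compactlyParametrized (hw_pos : ∀ B, 0 < w B) (hw_sum : Summable w)
    {H : Set (StatProc A)} (hH : DistClosed w H) (hsub : H ⊆ markovSources k A) :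
    ∃ C : Set (MarkovParam k A), CompactlyParametrized w C H := by
  obtain ⟨F, hF, hrange, -⟩ := exists_markovParam_map hw_pos hw_sum (A := A) k
  refine ⟨F ⁻¹' H, isCompact_iff_compactSpace.1 (hH.isClosed_preimage hF).isCompact,
    fun θ => F θ.1, fun θ => (hF θ.1).comp (continuous_subtype_val.tendsto θ), ?_⟩
  ext ρ
  constructor
  · rintro ⟨θ, rfl⟩
    exact θ.2
  · intro hρ
    obtain ⟨θ, rfl⟩ : ρ ∈ Set.range F := hrange ▸ hsub hρ
    exact ⟨⟨θ, hρ⟩, rfl⟩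

end Parametrization

end ErgodicTesting

theorem mainTheorem3 {A : Type*} [Fintype A] [DecidableEq A] [MeasurableSpace A]
    [DiscreteMeasurableSpace A]
    (w : List A → ℝ) (hw_pos : ∀ B, 0 < w B) (hw_sum : Summable w) :
    -- the general result
    (∀ (Θ₀ : Type*) (Θ₁ : Type*) [TopologicalSpace Θ₀] [TopologicalSpace Θ₁]
      (H₀ H₁ : Set (ErgodicTesting.StatProc A)),
      Disjoint H₀ H₁ →
      ErgodicTesting.CompactlyParametrized w Θ₀ H₀ →
      ErgodicTesting.CompactlyParametrized w Θ₁ H₁ →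
      ErgodicTesting.ClosedUnderErgodicDecomposition H₀ →
      ErgodicTesting.ClosedUnderErgodicDecomposition H₁ →
      ∃ φ : List A → Fin 2, ErgodicTesting.UniformlyConsistent φ H₀ H₁) ∧
    -- the set of all Markov sources of order `k` is an example
    (∀ k : ℕ,
      CompactSpace (ErgodicTesting.MarkovParam k A) ∧
      (∃ F : ErgodicTesting.MarkovParam k A → ErgodicTesting.StatProc A,
        ErgodicTesting.DistContinuous w F ∧
        Set.range F = ErgodicTesting.markovSources k A ∧
        ∀ θ : ErgodicTesting.MarkovParam k A,
          ErgodicTesting.HasTransitions θ.1.2 (F θ) ∧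
          ∀ s : Fin k → A, (F θ).prob (List.ofFn s) = (θ.1.1 : (Fin k → A) → ℝ) s) ∧
      ErgodicTesting.ClosedUnderErgodicDecomposition (ErgodicTesting.markovSources k A)) ∧
    -- so is a closed set of transition probabilities, each of which determines its source
    (∀ (k : ℕ) (T : Set (ErgodicTesting.Transitions k A)), IsClosed T →
      (∀ p ∈ T, ∃! ρ : ErgodicTesting.StatProc A, ErgodicTesting.HasTransitions p ρ) →
      CompactSpace T ∧
      (∃ F : T → ErgodicTesting.StatProc A,
        ErgodicTesting.DistContinuous w F ∧
        ∀ p : T, ErgodicTesting.HasTransitions p.1 (F p)) ∧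
      ErgodicTesting.ClosedUnderErgodicDecomposition
        {ρ | ∃ p ∈ T, ErgodicTesting.HasTransitions p ρ}) ∧
    -- and so are any two disjoint closed sets of ergodic Markov sources
    (∀ (k₀ k₁ : ℕ) (H₀ H₁ : Set (ErgodicTesting.StatProc A)),
      Disjoint H₀ H₁ →
      ErgodicTesting.DistClosed w H₀ →
      ErgodicTesting.DistClosed w H₁ →
      H₀ ⊆ ErgodicTesting.markovSources k₀ A →
      H₁ ⊆ ErgodicTesting.markovSources k₁ A →
      (∀ ρ ∈ H₀, ErgodicTesting.IsErgodic ρ) →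
      (∀ ρ ∈ H₁, ErgodicTesting.IsErgodic ρ) →
      (∃ C : Set (ErgodicTesting.MarkovParam k₀ A),
        ErgodicTesting.CompactlyParametrized w C H₀) ∧
      (∃ C : Set (ErgodicTesting.MarkovParam k₁ A),
        ErgodicTesting.CompactlyParametrized w C H₁) ∧
      ErgodicTesting.ClosedUnderErgodicDecomposition H₀ ∧
      ErgodicTesting.ClosedUnderErgodicDecomposition H₁ ∧
      ∃ φ : List A → Fin 2, ErgodicTesting.UniformlyConsistent φ H₀ H₁) := by
  refine ⟨?_, fun k => ⟨inferInstance, ErgodicTesting.exists_markovParam_map hw_pos hw_sum k, ?_⟩,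
    fun k T hT huniq => ⟨isCompact_iff_compactSpace.1 hT.isCompact,
      ErgodicTesting.exists_continuous_source hw_pos hw_sum huniq,
      ErgodicTesting.closedUnderErgodicDecomposition_hasTransitions T⟩, ?_⟩
  · intro Θ₀ Θ₁ _ _ H₀ H₁ hdisj hΘ₀ hΘ₁ he₀ he₁
    exact ErgodicTesting.exists_uniformlyConsistent hdisj
      (hΘ₀.isCompact_image_prob hw_pos hw_sum) (hΘ₁.isCompact_image_prob hw_pos hw_sum) he₀ he₁
  · simpa [ErgodicTesting.markovSources] using
      ErgodicTesting.closedUnderErgodicDecomposition_hasTransitions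
        (Set.univ : Set (ErgodicTesting.Transitions k A))
  · intro k₀ k₁ H₀ H₁ hdisj hc₀ hc₁ hm₀ hm₁ he₀ he₁
    obtain ⟨C₀, hC₀⟩ := ErgodicTesting.exists_compactlyParametrized hw_pos hw_sum hc₀ hm₀
    obtain ⟨C₁, hC₁⟩ := ErgodicTesting.exists_compactlyParametrized hw_pos hw_sum hc₁ hm₁
    have hd₀ := ErgodicTesting.closedUnderErgodicDecomposition_of_isErgodic he₀
    have hd₁ := ErgodicTesting.closedUnderErgodicDecomposition_of_isErgodic he₁
    exact ⟨⟨C₀, hC₀⟩, ⟨C₁, hC₁⟩, hd₀, hd₁, ErgodicTesting.exists_uniformlyConsistent hdisj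
      (hC₀.isCompact_image_prob hw_pos hw_sum) (hC₁.isCompact_image_prob hw_pos hw_sum) hd₀ hd₁⟩
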